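/- Let $\Sigma$ be a smooth (Hausdorff, second countable) three-manifold without boundary. A \emph{Cauchy pair} $(\mathfrak e,\Theta)$ on $\Sigma$ consists of a smooth global coframe $\mathfrak e=(e_u,e_l,e_n)$ and a smooth symmetric tensor $\Theta\in\Gamma(S^2T^*\Sigma)$. Let $\mathfrak e^\sharp=(e_u^\sharp,e_l^\sharp,e_n^\sharp)$ be the dual frame, which is the metric dual of $\mathfrak e$ with respect to $h_{\mathfrak e}=e_u\otimes e_u+e_l\otimes e_l+e_n\otimes e_n$, and write $\Theta(e_a)=\Theta(e_a^\sharp,\cdot)$. The pair is \emph{parallel} if $$\mathrm d e_a=\Theta(e_a)\wedge e_u\quad (a=u,l,n),\qquad [\Theta(e_u)]=0\in H^1(\Sigma,\mathbb R),$$ and \emph{complete} if the Riemannian manifold $(\Sigma,h_{\mathfrak e})$ is complete. Let $(\mathfrak e,\Theta)$ be a complete parallel Cauchy pair on $\Sigma$. Then the smooth vector fields $e_l^\sharp$ and $e_n^\sharp$ are complete and $[e_l^\sharp,e_n^\sharp]=0$. There is a unique action of the group $\mathbb R^2$ on $\Sigma$ for which, for every $p\in\Sigma$, the curves $t\mapsto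 (t,0)\cdot p$ and $t\mapsto(0,t)\cdot p$ are integral curves of $e_l^\sharp$ and $e_n^\sharp$ respectively. This action is smooth and locally free (every isotropy group is discrete), and its orbits are exactly the leaves of the foliation of $\Sigma$ tangent to $\ker e_u$, that is, the maximal connected integral manifolds of the distribution $\ker e_u\subset T\Sigma$. -/

import Mathlib

open scoped Manifold ContDiff ENNReal

noncomputable section

/-- Model space of three-manifolds. -/
abbrev E3 : Type := EuclideanSpace ℝ (Fin 3)

/-- Model space of surfaces. -/
abbrev E2 : Type := EuclideanSpace ℝ (Fin 2)

section Fields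

variable {S : Type*} [TopologicalSpace S] [ChartedSpace E3 S]

/-- A (not necessarily smooth) vector field on a three-manifold. -/
abbrev VField (S : Type*) [TopologicalSpace S] [ChartedSpace E3 S] : Type _ :=
  (x : S) → TangentSpace (𝓡 3) x

/-- A (not necessarily smooth) one-form on a three-manifold. -/
abbrev OneForm (S : Type*) [TopologicalSpace S] [ChartedSpace E3 S] : Type _ :=
  (x : S) → (TangentSpace (𝓡 3) x →L[ℝ] ℝ)

/-- A (not necessarily smooth) tensor field with two covariant slots on a three-manifold. -/
abbrev TwoTensor (S : Type*) [TopologicalSpace S] [ChartedSpace E3 S] : Type _ :=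
  (x : S) → (TangentSpace (𝓡 3) x →L[ℝ] TangentSpace (𝓡 3) x →L[ℝ] ℝ)

/-- Smooth sections of the tangent bundle. -/
def IsSmoothVField [IsManifold (𝓡 3) ∞ S] (X : VField S) : Prop :=
  ContMDiff (𝓡 3) ((𝓡 3).prod 𝓘(ℝ, E3)) ∞
    (fun x => (Bundle.TotalSpace.mk' E3 x (X x) : TangentBundle (𝓡 3) S))

/-- Smooth sections of the cotangent bundle. -/
def IsSmoothOneForm [IsManifold (𝓡 3) ∞ S] (a : OneForm S) : Prop :=
  ContMDiff (𝓡 3) ((𝓡 3).prod 𝓘(ℝ, E3 →L[ℝ] ℝ)) ∞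
    (fun x => Bundle.TotalSpace.mk' (E3 →L[ℝ] ℝ)
      (E := fun x : S => TangentSpace (𝓡 3) x →L[ℝ] ℝ) x (a x))

/-- Smooth sections of the bundle of bilinear forms on tangent spaces. -/
def IsSmoothTwoTensor [IsManifold (𝓡 3) ∞ S] (T : TwoTensor S) : Prop :=
  ContMDiff (𝓡 3) ((𝓡 3).prod 𝓘(ℝ, E3 →L[ℝ] E3 →L[ℝ] ℝ)) ∞
    (fun x => Bundle.TotalSpace.mk' (E3 →L[ℝ] E3 →L[ℝ] ℝ)
      (E := fun x : S => TangentSpace (𝓡 3) x →L[ℝ] TangentSpace (𝓡 3) x →L[ℝ] ℝ) x (T x))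

/-- The exterior derivative of a one-form evaluated on two vector fields, by the invariant formula
`da (X, Y) = X (a Y) - Y (a X) - a [X, Y]`; it is used for smooth `a`, `X`, `Y`. -/
def extD (a : OneForm S) (X Y : VField S) (x : S) : ℝ :=
  mvfderiv (𝓡 3) (fun y => a y (Y y)) x (X x) - mvfderiv (𝓡 3) (fun y => a y (X y)) x (Y x)
    - a x (VectorField.mlieBracket (𝓡 3) X Y x)

/-- The wedge product of two one-forms evaluated on two vector fields. -/
def wedge (a b : OneForm S) (X Y : VField S) (x : S) : ℝ :=
  a x (X x) * b x (Y x) - a x (Y x) * b x (X x)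

/-- The two-form equation `da = b ∧ c`, tested on all pairs of smooth vector fields. -/
def ExtDEqWedge [IsManifold (𝓡 3) ∞ S] (a b c : OneForm S) : Prop :=
  ∀ X Y : VField S, IsSmoothVField X → IsSmoothVField Y →
    ∀ x : S, extD a X Y x = wedge b c X Y x

/-- A one-form that is the differential of a globally defined smooth function, that is, a closed
one-form whose class in the first de Rham cohomology group vanishes. -/
def IsExactOneForm (a : OneForm S) : Prop :=
  ∃ f : S → ℝ, ContMDiff (𝓡 3) 𝓘(ℝ, ℝ) ∞ f ∧ ∀ x : S, a x = mvfderiv (𝓡 3) f x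

/-- A vector field is complete if through every point passes an integral curve that is defined for
all times. -/
def IsCompleteVField (X : VField S) : Prop :=
  ∀ p : S, ∃ c : ℝ → S, c 0 = p ∧ IsMIntegralCurve (I := 𝓡 3) c X

end Fields

/-- A Cauchy pair: a smooth global coframe `e = (e_u, e_l, e_n)` (the indices `0`, `1`, `2` stand
for `u`, `l`, `n`) and a smooth symmetric bilinear form `Th` on the tangent bundle. -/
structure CauchyPair (S : Type*) [TopologicalSpace S] [ChartedSpace E3 S]
    [IsManifold (𝓡 3) ∞ S] where
  e : Fin 3 → OneForm S
  e_smooth : ∀ i, IsSmoothOneForm (e i)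
  e_indep : ∀ x : S, LinearIndependent ℝ (fun i => e i x)
  Th : TwoTensor S
  Th_smooth : IsSmoothTwoTensor Th
  Th_symm : ∀ (x : S) (v w : TangentSpace (𝓡 3) x), Th x v w = Th x w v

namespace CauchyPair

variable {S : Type*} [TopologicalSpace S] [ChartedSpace E3 S] [IsManifold (𝓡 3) ∞ S]

/-- The three covectors of the coframe at `x`, as a linear map to `ℝ³`. -/
def coord (P : CauchyPair S) (x : S) : TangentSpace (𝓡 3) x →ₗ[ℝ] (Fin 3 → ℝ) :=
  LinearMap.pi fun i => (P.e i x).toLinearMap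

theorem coord_bijective (P : CauchyPair S) (x : S) : Function.Bijective (P.coord x) := by
  have hsurj : Function.Surjective (P.coord x) := by
    rw [← LinearMap.range_eq_top]
    by_contra hne
    obtain ⟨φ, hφ, hle⟩ := Submodule.exists_le_ker_of_lt_top _ (lt_top_iff_ne_top.2 hne)
    have hz : ∑ i, φ (Pi.single i 1) • P.e i x = 0 := by
      ext v
      have h1 : φ (P.coord x v) = 0 := hle ⟨v, rfl⟩
      rw [pi_eq_sum_univ' (P.coord x v), map_sum] at h1
      simp only [map_smul, smul_eq_mul] at h1
      rw [sum_apply]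
      simp only [smul_apply, smul_eq_mul, zero_apply]
      rw [← h1]
      refine Finset.sum_congr rfl fun i _ => ?_
      rw [mul_comm]
      congr 2
    have hc := Fintype.linearIndependent_iff.1 (P.e_indep x) _ hz
    apply hφ
    refine LinearMap.pi_ext' fun i => ?_
    ext
    simpa using hc i
  have : FiniteDimensional ℝ (TangentSpace (𝓡 3) x) :=
    inferInstanceAs (FiniteDimensional ℝ E3)
  have hdim : Module.finrank ℝ (TangentSpace (𝓡 3) x) = Module.finrank ℝ (Fin 3 → ℝ) := by
    have h3 : Module.finrank ℝ E3 = 3 := by simp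
    rw [Module.finrank_fin_fun]
    exact h3
  exact ⟨(LinearMap.injective_iff_surjective_of_finrank_eq_finrank hdim).2 hsurj, hsurj⟩

/-- The frame `e^♯` dual to the coframe: `e_j (e_i^♯) = δ_ij`. -/
def sharp (P : CauchyPair S) (i : Fin 3) : VField S := fun x =>
  (LinearEquiv.ofBijective (P.coord x) (P.coord_bijective x)).symm (Pi.single i 1)

theorem e_sharp (P : CauchyPair S) (i j : Fin 3) (x : S) :
    P.e j x (P.sharp i x) = if j = i then 1 else 0 := by
  have h : P.coord x (P.sharp i x) = Pi.single i 1 :=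
    (LinearEquiv.ofBijective (P.coord x) (P.coord_bijective x)).apply_symm_apply _
  have h2 := congrFun h j
  rw [Pi.single_apply] at h2
  exact h2

/-- The Riemannian metric `h = e_u ⊗ e_u + e_l ⊗ e_l + e_n ⊗ e_n` of the coframe. -/
def metric (P : CauchyPair S) (x : S) (v w : TangentSpace (𝓡 3) x) : ℝ :=
  ∑ i, P.e i x v * P.e i x w

/-- The dual frame consists of the metric duals of the coframe. -/
theorem metric_sharp (P : CauchyPair S) (i : Fin 3) (x : S) (w : TangentSpace (𝓡 3) x) :
    P.metric x (P.sharp i x) w = P.e i x w := by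
  simp [metric, e_sharp]

/-- The one-form `Θ(e_i) = Θ(e_i^♯, ·)`. -/
def thE (P : CauchyPair S) (i : Fin 3) : OneForm S := fun x => P.Th x (P.sharp i x)

/-- The parallel Cauchy differential system: `de = Θ(e) ∧ e_u` and `[Θ(e_u)] = 0`. -/
structure IsParallel (P : CauchyPair S) : Prop where
  ext_eq : ∀ i, ExtDEqWedge (P.e i) (P.thE i) (P.e 0)
  exact_u : IsExactOneForm (P.thE 0)

/-- The Riemannian distance of the metric of the coframe, the infimum of the lengths of `C^1`
paths (infinite between different components). -/
def rDist (P : CauchyPair S) (x y : S) : ℝ≥0∞ :=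
  letI : ∀ x : S, ENorm (TangentSpace (𝓡 3) x) :=
    fun x => ⟨fun v => ENNReal.ofReal (Real.sqrt (P.metric x v v))⟩
  Manifold.riemannianEDist (𝓡 3) x y

/-- Completeness of the Riemannian manifold `(S, h)`: Cauchy sequences for the Riemannian distance
converge (the topology of that distance is the topology of the manifold). -/
def IsComplete (P : CauchyPair S) : Prop :=
  ∀ s : ℕ → S,
    (∀ ε : ℝ≥0∞, 0 < ε → ∃ N, ∀ m ≥ N, ∀ n ≥ N, P.rDist (s m) (s n) < ε) →
    ∃ p : S, Filter.Tendsto s Filter.atTop (nhds p)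

end CauchyPair

section Leaves

/-- `L` is a connected integral manifold of the plane distribution `ker a`: the image of a nonempty
connected surface under an injective smooth immersion whose tangent planes are the planes of the
distribution. -/
def IsIntegralSurface.{u} {S : Type u} [TopologicalSpace S] [ChartedSpace E3 S]
    (a : OneForm S) (L : Set S) : Prop :=
  ∃ (N : Type u) (_ : TopologicalSpace N) (_ : ChartedSpace E2 N) (f : N → S),
    IsManifold (𝓡 2) ∞ N ∧ T2Space N ∧ SecondCountableTopology N ∧ ConnectedSpace N ∧
    ContMDiff (𝓡 2) (𝓡 3) ∞ f ∧ Function.Injective f ∧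
    (∀ y : N, Function.Injective (mfderiv (𝓡 2) (𝓡 3) f y)) ∧
    (∀ y : N, Set.range (mfderiv (𝓡 2) (𝓡 3) f y) = {v | a (f y) v = 0}) ∧
    Set.range f = L

/-- The leaves of the foliation tangent to `ker a`: its maximal connected integral manifolds. -/
def IsLeaf.{u} {S : Type u} [TopologicalSpace S] [ChartedSpace E3 S]
    (a : OneForm S) (L : Set S) : Prop :=
  IsIntegralSurface a L ∧ ∀ L' : Set S, IsIntegralSurface a L' → L ⊆ L' → L' = L

end Leaves

section Actions

variable {S : Type*} [TopologicalSpace S] [ChartedSpace E3 S]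

/-- The action `A` of `ℝ²` is generated by the vector fields `X`, `Y`: the first and the second
factor act by their flows. -/
def IsGeneratedBy (A : AddAction (ℝ × ℝ) S) (X Y : VField S) : Prop :=
  ∀ p : S, IsMIntegralCurve (I := 𝓡 3) (fun t : ℝ => ((t, 0) : ℝ × ℝ) +ᵥ p) X ∧
    IsMIntegralCurve (I := 𝓡 3) (fun t : ℝ => ((0, t) : ℝ × ℝ) +ᵥ p) Y

/-- The action map `ℝ² × S → S` is smooth. -/
def IsSmoothAction (A : AddAction (ℝ × ℝ) S) : Prop :=
  ContMDiffVAdd 𝓘(ℝ, ℝ × ℝ) (𝓡 3) ∞ (ℝ × ℝ) S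

/-- The action is locally free: all isotropy groups are discrete. -/
def IsLocallyFreeAction (A : AddAction (ℝ × ℝ) S) : Prop :=
  ∀ p : S, DiscreteTopology (AddAction.stabilizer (ℝ × ℝ) p)

/-- The set of orbits of the action. -/
def orbitSet (A : AddAction (ℝ × ℝ) S) : Set (Set S) :=
  Set.range fun p : S => AddAction.orbit (ℝ × ℝ) p

end Actions

end

/-!
In the dual frame the equations `de_a = Θ(e_a) ∧ e_u` give
`e_a [e_l^♯, e_n^♯] = -de_a (e_l^♯, e_n^♯) = 0` for every `a`, because `e_u` vanishes on `e_l^♯` and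
`e_n^♯`. These fields are orthonormal, so an integral curve defined on a bounded time interval is
Lipschitz for the Riemannian distance and converges at the ends of the interval: the fields are
complete, and their commuting flows form a smooth action of `ℝ²`.

The differential of the orbit map `v ↦ v +ᵥ p` is `(a, b) ↦ a • e_l^♯ + b • e_n^♯`, an isomorphism
onto `ker e_u`. Hence isotropy groups are discrete, and every orbit with the quotient topology of
`ℝ²` is an injectively immersed integral surface. Conversely, a curve `γ` tangent to `ker e_u` has
velocity `a t • e_l^♯ + b t • e_n^♯`, and its translate by `-∫ (a, b)` has zero velocity; so `γ`
stays in an orbit, and the orbits are the maximal integral surfaces.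

Flows are smooth because the rescaled integral equation `u = x + t • ∫ v ∘ u` on the Banach space
`C([0, 1], E)` can be solved for `u` by the inverse function theorem, smoothly in `(t, x)`.
-/

open Set Filter Topology

noncomputable section

section Superposition

universe u

variable {K : Type*} [TopologicalSpace K] [CompactSpace K] {E F : Type u} [NormedAddCommGroup E]
  [NormedSpace ℝ E] [NormedAddCommGroup F] [NormedSpace ℝ F]

/-- Pointwise application of a continuous family of operators to a continuous family of vectors,
as a bounded bilinear map. It describes the derivative of `u ↦ f ∘ u` on `C(K, E)`. -/
def pointwiseApply : C(K, E →L[ℝ] F) →L[ℝ] C(K, E) →L[ℝ] C(K, F) :=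
  LinearMap.mkContinuous₂
    (LinearMap.mk₂ ℝ (fun (A : C(K, E →L[ℝ] F)) (u : C(K, E)) =>
        (⟨fun k => A k (u k), by fun_prop⟩ : C(K, F)))
      (fun _ _ _ => rfl) (fun _ _ _ => rfl)
      (fun A u w => ContinuousMap.ext fun k => map_add (A k) (u k) (w k))
      (fun c A u => ContinuousMap.ext fun k => map_smul (A k) c (u k))) 1
    fun A u => by
      rw [one_mul]
      exact (ContinuousMap.norm_le _ (by positivity)).2 fun k =>
        (A k).le_of_opNorm_le_of_le (A.norm_coe_le_norm k) (u.norm_coe_le_norm k)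

theorem hasFDerivAt_postcomp {f : C(E, F)} {f' : C(E, E →L[ℝ] F)}
    (hf : ∀ x, HasFDerivAt f (f' x) x) (u : C(K, E)) :
    HasFDerivAt (fun w : C(K, E) => f.comp w) (pointwiseApply (f'.comp u)) u := by
  refine .of_isLittleO (Asymptotics.isLittleO_iff.2 fun ε hε => ?_)
  have hcont : Continuous fun w : C(K, E) => f'.comp w := ContinuousMap.continuous_postcomp f'
  have hclose : ∀ᶠ w in 𝓝 u, dist (f'.comp w) (f'.comp u) < ε :=
    hcont.continuousAt (Metric.ball_mem_nhds (f'.comp u) hε)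
  obtain ⟨δ, hδ, hball⟩ := Metric.eventually_nhds_iff_ball.1 hclose
  filter_upwards [Metric.ball_mem_nhds u hδ] with w hw
  refine (ContinuousMap.norm_le _ (by positivity)).2 fun k => ?_
  have hderiv : ∀ x ∈ segment ℝ (u k) (w k), ‖f' x - f' (u k)‖ ≤ ε := by
    rintro x ⟨a, b, ha, hb, hab, rfl⟩
    have hmem : a • u + b • w ∈ Metric.ball u δ :=
      convex_ball u δ (Metric.mem_ball_self hδ) hw ha hb hab
    rw [← dist_eq_norm]
    exact (ContinuousMap.dist_apply_le_dist k).trans (hball _ hmem).le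
  have hmean := (convex_segment (u k) (w k)).norm_image_sub_le_of_norm_hasFDerivWithin_le'
    (fun x _ => (hf x).hasFDerivWithinAt) hderiv (left_mem_segment ℝ _ _) (right_mem_segment ℝ _ _)
  exact hmean.trans (mul_le_mul_of_nonneg_left ((w - u).norm_coe_le_norm k) hε.le)

theorem contDiff_nat_postcomp {n : ℕ} {f : C(E, F)} (hf : ContDiff ℝ n f) :
    ContDiff ℝ n fun u : C(K, E) => f.comp u := by
  induction n generalizing F with
  | zero => exact contDiff_zero.2 (ContinuousMap.continuous_postcomp f)
  | succ n ih =>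
    have hf' : ContDiff ℝ n (fderiv ℝ f) := hf.fderiv_right le_rfl
    have hderiv : ∀ x, HasFDerivAt f (fderiv ℝ f x) x := fun x =>
      (hf.differentiable (by simp) x).hasFDerivAt
    exact contDiff_succ_iff_hasFDerivAt.2 ⟨_, pointwiseApply.contDiff.comp
      (ih (f := ⟨fderiv ℝ f, hf'.continuous⟩) hf'), hasFDerivAt_postcomp hderiv⟩

theorem contDiff_infty_postcomp {f : C(E, F)} (hf : ContDiff ℝ ∞ f) :
    ContDiff ℝ ∞ fun u : C(K, E) => f.comp u :=
  contDiff_infty.2 fun _ => contDiff_nat_postcomp (contDiff_infty.1 hf _)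

end Superposition

theorem eventually_exists_fderiv_eq_equiv {E F : Type*} [NormedAddCommGroup E] [NormedSpace ℝ E]
    [CompleteSpace E] [NormedAddCommGroup F] [NormedSpace ℝ F] {Φ : E → F} {a : E}
    (hΦ : ContDiffAt ℝ 1 Φ a) {L : E ≃L[ℝ] F} (hL : fderiv ℝ Φ a = L) :
    ∀ᶠ y in 𝓝 a, ∃ M : E ≃L[ℝ] F, fderiv ℝ Φ y = M := by
  have hcont : ContinuousAt (fderiv ℝ Φ) a := (hΦ.fderiv_right (m := 0) (by simp)).continuousAt
  filter_upwards [hcont (hL ▸ L.nhds)] with y ⟨M, hM⟩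
  exact ⟨M, hM.symm⟩

theorem exists_smooth_openPartialHomeomorph {E F : Type*} [NormedAddCommGroup E] [NormedSpace ℝ E]
    [CompleteSpace E] [NormedAddCommGroup F] [NormedSpace ℝ F] {Φ : E → F} {a : E}
    (hΦ : ∀ᶠ y in 𝓝 a, ContDiffAt ℝ ∞ Φ y) {L : E ≃L[ℝ] F} (hL : fderiv ℝ Φ a = L) :
    ∃ ψ : OpenPartialHomeomorph E F, a ∈ ψ.source ∧ (ψ : E → F) = Φ ∧
      ∀ y ∈ ψ.target, ContDiffAt ℝ ∞ ψ.symm y := by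
  have hΦa : ContDiffAt ℝ ∞ Φ a := hΦ.self_of_nhds
  have hderiv : HasFDerivAt Φ (L : E →L[ℝ] F) a :=
    hL ▸ (hΦa.differentiableAt (by simp)).hasFDerivAt
  obtain ⟨W, hW, hWo, haW⟩ := eventually_nhds_iff.1
    (hΦ.and (eventually_exists_fderiv_eq_equiv (hΦa.of_le (by simp)) hL))
  let ψ := (hΦa.toOpenPartialHomeomorph Φ hderiv (by simp)).restrOpen W hWo
  refine ⟨ψ, ⟨hΦa.mem_toOpenPartialHomeomorph_source hderiv (by simp), haW⟩, rfl, fun y hy => ?_⟩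
  obtain ⟨hsmooth, M, hM⟩ := hW _ (ψ.map_target hy).2
  have hψ : HasFDerivAt ψ (M : E →L[ℝ] F) (ψ.symm y) :=
    hM ▸ (hsmooth.differentiableAt (by simp)).hasFDerivAt
  exact ψ.contDiffAt_symm hy hψ hsmooth

section Flow

open scoped unitInterval

variable {E : Type*} [NormedAddCommGroup E] [NormedSpace ℝ E]

/-- The Volterra operator `u ↦ (s ↦ ∫ r in 0..s, u r)` on `C([0, 1], E)`. -/
def primitive : C(I, E) →L[ℝ] C(I, E) :=
  LinearMap.mkContinuous
    { toFun u := ⟨fun s => ∫ r in (0 : ℝ)..s, IccExtend zero_le_one u r,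
        (intervalIntegral.continuous_primitive
          (fun _ _ => u.continuous.Icc_extend'.intervalIntegrable _ _) 0).comp
            continuous_subtype_val⟩
      map_add' u w := ContinuousMap.ext fun s => intervalIntegral.integral_add
        (u.continuous.Icc_extend'.intervalIntegrable _ _)
        (w.continuous.Icc_extend'.intervalIntegrable _ _)
      map_smul' c u := ContinuousMap.ext fun s => intervalIntegral.integral_smul c _ } 1
    fun u => by
      rw [one_mul]
      refine (ContinuousMap.norm_le _ (norm_nonneg u)).2 fun s => ?_
      have hbound : ∀ r ∈ uIoc (0 : ℝ) s, ‖IccExtend zero_le_one u r‖ ≤ ‖u‖ := fun r _ =>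
        u.norm_coe_le_norm _
      refine (intervalIntegral.norm_integral_le_of_norm_le_const hbound).trans ?_
      rw [sub_zero, abs_of_nonneg s.2.1]
      exact mul_le_of_le_one_right (norm_nonneg u) s.2.2

/-- The Picard integral equation `u s = x + t ∫ r in 0..s, v (u r)` on `[0, 1]`, where `z = (t, x)`;
its solution is the integral curve of `v` through `x` with time rescaled by `t`. -/
def IsPicardSolution (v : C(E, E)) (z : ℝ × E) (u : C(I, E)) : Prop :=
  u = ContinuousMap.const I z.2 + z.1 • primitive (v.comp u)

theorem isPicardSolution_iff {v : C(E, E)} {z : ℝ × E} {u : C(I, E)} :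
    IsPicardSolution v z u ↔
      ∀ s : I, u s = z.2 + z.1 • ∫ r in (0 : ℝ)..s, v (IccExtend zero_le_one u r) :=
  ContinuousMap.ext_iff

theorem isPicardSolution_zero_iff {v : C(E, E)} {x : E} {u : C(I, E)} :
    IsPicardSolution v (0, x) u ↔ u = ContinuousMap.const I x := by
  rw [IsPicardSolution, zero_smul, add_zero]

/-- Precomposition with `r ↦ s * r` on `C([0, 1], E)`, which restricts a curve to `[0, s]`. -/
def rescale (s : I) (u : C(I, E)) : C(I, E) :=
  u.comp ⟨fun r => s * r, by fun_prop⟩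

theorem IsPicardSolution.rescale {v : C(E, E)} {z : ℝ × E} {u : C(I, E)}
    (hu : IsPicardSolution v z u) (s : I) :
    IsPicardSolution v (z.1 * s, z.2) (rescale s u) := by
  refine isPicardSolution_iff.2 fun q => ?_
  have hext : ∀ r ∈ uIcc (0 : ℝ) q, v (IccExtend zero_le_one (_root_.rescale s u) r) =
      v (IccExtend zero_le_one u (s * r)) := fun r hr => by
    rw [uIcc_of_le q.2.1] at hr
    have hrI : r ∈ I := ⟨hr.1, hr.2.trans q.2.2⟩
    rw [IccExtend_of_mem _ _ hrI, IccExtend_of_mem _ _ (unitInterval.mul_mem s.2 hrI)]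
    rfl
  rw [intervalIntegral.integral_congr hext, mul_smul,
    intervalIntegral.smul_integral_comp_mul_left (fun r => v (IccExtend zero_le_one u r)), mul_zero]
  exact isPicardSolution_iff.1 hu (s * q)

theorem contDiff_picardMap {v : C(E, E)} (hv : ContDiff ℝ ∞ v) :
    ContDiff ℝ ∞ fun p : ℝ × C(I, E) => (p.1, p.2 - p.1 • primitive (v.comp p.2)) :=
  contDiff_fst.prodMk (contDiff_snd.sub (contDiff_fst.smul
    (primitive.contDiff.comp ((contDiff_infty_postcomp hv).comp contDiff_snd))))

theorem fderiv_picardMap_zero {v : C(E, E)} (hv : ContDiff ℝ ∞ v) (u : C(I, E)) :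
    fderiv ℝ (fun p : ℝ × C(I, E) => (p.1, p.2 - p.1 • primitive (v.comp p.2))) (0, u) =
      (ContinuousLinearEquiv.refl ℝ ℝ).skewProd (ContinuousLinearEquiv.refl ℝ C(I, E))
        (-ContinuousLinearMap.toSpanSingleton ℝ (primitive (v.comp u))) := by
  have hprim : DifferentiableAt ℝ (fun p : ℝ × C(I, E) => primitive (v.comp p.2)) (0, u) :=
    (primitive.contDiff.comp ((contDiff_infty_postcomp hv).comp contDiff_snd)).differentiable
      (by simp) _
  have hsnd := (hasFDerivAt_snd (𝕜 := ℝ) (p := ((0 : ℝ), u))).sub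
    ((hasFDerivAt_fst (𝕜 := ℝ) (p := ((0 : ℝ), u))).smul hprim.hasFDerivAt)
  refine (hasFDerivAt_fst.prodMk hsnd).fderiv.trans (ContinuousLinearMap.ext fun p => ?_)
  simp [sub_eq_add_neg]

theorem contDiff_continuousMap_const : ContDiff ℝ ∞ fun x : E => ContinuousMap.const I x :=
  ContinuousLinearMap.contDiff
    { toFun := ContinuousMap.const I
      map_add' _ _ := rfl
      map_smul' _ _ := rfl
      cont := ContinuousMap.continuous_const' }

/-- The Picard equation is inverted by applying the inverse function theorem to
`(t, u) ↦ (t, u - t ∫ v ∘ u)`, whose derivative at `(0, u)` is a shear. -/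
theorem exists_contDiff_picardSolution [CompleteSpace E] {v : C(E, E)} (hv : ContDiff ℝ ∞ v)
    (a : E) :
    ∃ ψ : ℝ × E → C(I, E), (∀ᶠ z in 𝓝 (0, a), ContDiffAt ℝ ∞ ψ z ∧ IsPicardSolution v z (ψ z)) ∧
      ∀ᶠ p in 𝓝 (((0, a), ContinuousMap.const I a) : (ℝ × E) × C(I, E)),
        IsPicardSolution v p.1 p.2 → ψ p.1 = p.2 := by
  obtain ⟨G, ha, hG, hsymm⟩ := exists_smooth_openPartialHomeomorph
    (.of_forall fun p => (contDiff_picardMap hv).contDiffAt)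
    (fderiv_picardMap_zero hv (ContinuousMap.const I a))
  let ι : ℝ × E → ℝ × C(I, E) := fun z => (z.1, ContinuousMap.const I z.2)
  have hι : ContDiff ℝ ∞ ι :=
    contDiff_fst.prodMk (contDiff_continuousMap_const.comp contDiff_snd)
  have hG_apply : ∀ p, G p = (p.1, p.2 - p.1 • primitive (v.comp p.2)) := congrFun hG
  have hsolution : ∀ z u, IsPicardSolution v z u ↔ G (z.1, u) = ι z := fun z u => by
    simp only [IsPicardSolution, hG_apply, ι, Prod.mk.injEq, true_and, sub_eq_iff_eq_add]
  have hιa : ι (0, a) ∈ G.target := by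
    have : G (0, ContinuousMap.const I a) = ι (0, a) :=
      (hsolution (0, a) _).1 (isPicardSolution_zero_iff.2 rfl)
    exact this ▸ G.map_source ha
  refine ⟨fun z => (G.symm (ι z)).2, ?_, ?_⟩
  · filter_upwards [hι.continuous.continuousAt (G.open_target.mem_nhds hιa)] with z hz
    refine ⟨((hsymm _ hz).comp z hι.contDiffAt).snd, (hsolution _ _).2 ?_⟩
    have hfst : (G.symm (ι z)).1 = z.1 := by
      rw [← congrArg Prod.fst (G.right_inv hz), hG_apply]
    exact hfst ▸ G.right_inv hz
  · have hpair : ContinuousAt (fun p : (ℝ × E) × C(I, E) => (p.1.1, p.2))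
        ((0, a), ContinuousMap.const I a) := by fun_prop
    filter_upwards [hpair (G.open_source.mem_nhds ha)] with p hp hsol
    rw [← (hsolution _ _).1 hsol, G.left_inv hp]

omit [NormedSpace ℝ E] in
theorem norm_rescale_sub_const_le (s : I) (u : C(I, E)) (a : E) :
    ‖rescale s u - ContinuousMap.const I a‖ ≤ ‖u - ContinuousMap.const I a‖ :=
  (ContinuousMap.norm_le _ (norm_nonneg _)).2 fun r =>
    (u - ContinuousMap.const I a).norm_coe_le_norm (s * r)

/-- Rescaled solutions solve the rescaled equation, so by local uniqueness the solution with
parameters `(t, x)` runs through the endpoints of the solutions with parameters `(t s, x)`. -/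
theorem exists_contDiff_picardSolution_endpoint [CompleteSpace E] {v : C(E, E)}
    (hv : ContDiff ℝ ∞ v) (a : E) :
    ∃ φ : ℝ × E → E, ∀ᶠ z in 𝓝 (0, a), ContDiffAt ℝ ∞ φ z ∧
      ∃ u, IsPicardSolution v z u ∧ ∀ s : I, u s = φ (z.1 * s, z.2) := by
  obtain ⟨ψ, hψ, hunique⟩ := exists_contDiff_picardSolution hv a
  have hψa : ψ (0, a) = ContinuousMap.const I a :=
    isPicardSolution_zero_iff.1 hψ.self_of_nhds.2
  obtain ⟨δ, hδ, hball⟩ := Metric.eventually_nhds_iff_ball.1 hunique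
  have hclose : ∀ᶠ z in 𝓝 (0, a), dist (ψ z) (ContinuousMap.const I a) < δ :=
    hψa ▸ hψ.self_of_nhds.1.continuousAt (Metric.ball_mem_nhds _ hδ)
  refine ⟨fun z => ψ z 1, ?_⟩
  filter_upwards [hψ, hclose, Metric.ball_mem_nhds _ hδ] with z ⟨hsmooth, hsol⟩ hzψ hz
  refine ⟨(ContinuousMap.evalCLM ℝ (1 : I) : C(I, E) →L[ℝ] E).contDiff.contDiffAt.comp z hsmooth,
    ψ z, hsol, fun s => ?_⟩
  obtain ⟨hzt, hzx⟩ := (ball_prod_same _ _ _).ge hz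
  have htime : z.1 * s ∈ Metric.ball 0 δ := by
    rw [mem_ball_zero_iff] at hzt ⊢
    exact (norm_mul_le _ _).trans (mul_le_of_le_one_right (norm_nonneg _)
      ((Real.norm_of_nonneg s.2.1).trans_le s.2.2)) |>.trans_lt hzt
  have hmem : ((z.1 * s, z.2), rescale s (ψ z)) ∈
      Metric.ball (((0, a), ContinuousMap.const I a) : (ℝ × E) × C(I, E)) δ := by
    rw [← ball_prod_same, ← ball_prod_same]
    rw [dist_eq_norm] at hzψ
    exact ⟨⟨htime, hzx⟩, mem_ball_iff_norm.2 ((norm_rescale_sub_const_le s _ a).trans_lt hzψ)⟩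
  rw [hball _ hmem (hsol.rescale s)]
  exact congrArg (ψ z) (Subtype.ext (mul_one (s : ℝ)).symm)

theorem exists_contDiff_eq_add_integral [CompleteSpace E] {v : C(E, E)} (hv : ContDiff ℝ ∞ v)
    (a : E) :
    ∃ φ : ℝ × E → E, ∀ᶠ z in 𝓝 (0, a), ContDiffAt ℝ ∞ φ z ∧
      φ z = z.2 + ∫ r in (0 : ℝ)..z.1, v (φ (r, z.2)) := by
  obtain ⟨φ, hφ⟩ := exists_contDiff_picardSolution_endpoint hv a
  refine ⟨φ, hφ.mono fun z ⟨hsmooth, u, hsol, hu⟩ => ⟨hsmooth, ?_⟩⟩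
  have hintegrand : ∀ r ∈ uIcc (0 : ℝ) 1,
      v (IccExtend zero_le_one u r) = v (φ (z.1 * r, z.2)) := fun r hr => by
    rw [uIcc_of_le zero_le_one] at hr
    rw [IccExtend_of_mem _ _ hr, hu]
  have hend := isPicardSolution_iff.1 hsol 1
  rw [hu 1, Icc.coe_one, intervalIntegral.integral_congr hintegrand,
    intervalIntegral.smul_integral_comp_mul_left (fun r => v (φ (r, z.2)))] at hend
  simpa only [mul_one, mul_zero] using hend

/-- Smooth dependence of the solutions of an autonomous differential equation on time and initial
value. -/
theorem exists_contDiff_localFlow [CompleteSpace E] {v : C(E, E)} (hv : ContDiff ℝ ∞ v) (a : E) :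
    ∃ φ : ℝ × E → E, ∀ᶠ z in 𝓝 (0, a), ContDiffAt ℝ ∞ φ z ∧ φ (0, z.2) = z.2 ∧
      HasDerivAt (fun t => φ (t, z.2)) (v (φ z)) z.1 := by
  obtain ⟨φ, hφ⟩ := exists_contDiff_eq_add_integral hv a
  obtain ⟨δ, hδ, hball⟩ := Metric.eventually_nhds_iff_ball.1 hφ
  refine ⟨φ, ?_⟩
  filter_upwards [Metric.ball_mem_nhds _ hδ] with z hz
  obtain ⟨hzt, hzx⟩ := (ball_prod_same _ _ _).ge hz
  have hline : ∀ t ∈ Metric.ball (0 : ℝ) δ, (t, z.2) ∈ Metric.ball ((0 : ℝ), a) δ :=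
    fun t ht => (ball_prod_same _ _ _).le ⟨ht, hzx⟩
  have hcont : ContinuousOn (fun t => v (φ (t, z.2))) (Metric.ball 0 δ) := fun t ht =>
    (v.continuous.continuousAt.comp ((hball _ (hline t ht)).1.continuousAt.comp
      (f := fun t => (t, z.2)) (by fun_prop))).continuousWithinAt
  have hsegment : uIcc 0 z.1 ⊆ Metric.ball 0 δ :=
    ((convex_ball (0 : ℝ) δ).ordConnected.uIcc_subset (Metric.mem_ball_self hδ) hzt)
  have hderiv := (intervalIntegral.integral_hasDerivAt_right
    (hcont.mono hsegment).intervalIntegrable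
    (hcont.stronglyMeasurableAtFilter Metric.isOpen_ball _ hzt)
    (hcont.continuousAt (Metric.isOpen_ball.mem_nhds hzt))).const_add z.2
  refine ⟨(hball z hz).1, ?_, hderiv.congr_of_eventuallyEq ?_⟩
  · simpa using (hball _ (hline 0 (Metric.mem_ball_self hδ))).2
  · filter_upwards [Metric.isOpen_ball.mem_nhds hzt] with t ht
    exact (hball _ (hline t ht)).2

end Flow

section FlowGerm

variable {E : Type*} [NormedAddCommGroup E] [NormedSpace ℝ E]

theorem exists_contDiff_eventuallyEq [FiniteDimensional ℝ E] {F : Type*} [NormedAddCommGroup F]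
    [NormedSpace ℝ F] {f : E → F} {a : E} (hf : ∀ᶠ y in 𝓝 a, ContDiffAt ℝ ∞ f y) :
    ∃ g : E → F, ContDiff ℝ ∞ g ∧ g =ᶠ[𝓝 a] f := by
  obtain ⟨r, hr, hball⟩ := Metric.eventually_nhds_iff_ball.1 hf
  let χ : ContDiffBump a := ⟨r / 4, r / 2, by positivity, by linarith⟩
  refine ⟨fun y => χ y • f y, contDiff_iff_contDiffAt.2 fun y => ?_, ?_⟩
  · by_cases hy : y ∈ Metric.ball a r
    · exact χ.contDiffAt.smul (hball y hy)
    · have hyχ : y ∈ (tsupport χ)ᶜ := by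
        rw [χ.tsupport_eq, mem_compl_iff, Metric.mem_closedBall, not_le]
        exact (half_lt_self hr).trans_le (not_lt.1 hy)
      refine (contDiffAt_const (c := (0 : F))).congr_of_eventuallyEq ?_
      filter_upwards [(isClosed_tsupport χ).isOpen_compl.mem_nhds hyχ] with w hw
      rw [image_eq_zero_of_notMem_tsupport hw, zero_smul]
  · filter_upwards [χ.eventuallyEq_one] with y hy
    rw [hy, Pi.one_apply, one_smul]

theorem exists_contDiffAt_localFlow [FiniteDimensional ℝ E] {v : E → E} {a : E}
    (hv : ∀ᶠ y in 𝓝 a, ContDiffAt ℝ ∞ v y) :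
    ∃ φ : ℝ × E → E, ∀ᶠ z in 𝓝 (0, a), ContDiffAt ℝ ∞ φ z ∧ φ (0, z.2) = z.2 ∧
      HasDerivAt (fun t => φ (t, z.2)) (v (φ z)) z.1 := by
  have : CompleteSpace E := FiniteDimensional.complete ℝ E
  obtain ⟨g, hg, hgv⟩ := exists_contDiff_eventuallyEq hv
  obtain ⟨φ, hφ⟩ := exists_contDiff_localFlow (v := ⟨g, hg.continuous⟩) hg a
  have hlim : Tendsto φ (𝓝 (0, a)) (𝓝 a) := by
    simpa only [hφ.self_of_nhds.2.1] using hφ.self_of_nhds.1.continuousAt.tendsto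
  exact ⟨φ, by filter_upwards [hφ, hlim.eventually hgv] with z ⟨hsmooth, hinit, hderiv⟩ hz using
    ⟨hsmooth, hinit, hz ▸ hderiv⟩⟩

theorem fderiv_apply_one_zero {φ : ℝ × E → E} {z : ℝ × E} {v : E} (hφ : DifferentiableAt ℝ φ z)
    (hv : HasDerivAt (fun t => φ (t, z.2)) v z.1) : fderiv ℝ φ z (1, 0) = v :=
  (hφ.hasFDerivAt.comp_hasDerivAt z.1
    ((hasDerivAt_id z.1).prodMk (hasDerivAt_const z.1 z.2))).unique hv

theorem fderiv_zero_apply_of_eventuallyEq {φ : ℝ × E → E} {x : E}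
    (hφ : DifferentiableAt ℝ φ (0, x)) (hinit : (fun y => φ (0, y)) =ᶠ[𝓝 x] id) (w : E) :
    fderiv ℝ φ (0, x) (0, w) = w :=
  DFunLike.congr_fun ((hφ.hasFDerivAt.comp x (hasFDerivAt_prodMk_right 0 x)).unique
    ((hasFDerivAt_id x).congr_of_eventuallyEq hinit)) w

/-- The variational equation. -/
theorem hasDerivAt_fderiv_localFlow {φ : ℝ × E → E} {v : E → E} {z : ℝ × E}
    (hφ : ContDiffAt ℝ 2 φ z)
    (hflow : ∀ᶠ y in 𝓝 z, HasDerivAt (fun t => φ (t, y.2)) (v (φ y)) y.1)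
    (hv : DifferentiableAt ℝ v (φ z)) (w : E) :
    HasDerivAt (fun t => fderiv ℝ φ (t, z.2) (0, w)) (fderiv ℝ v (φ z) (fderiv ℝ φ z (0, w)))
      z.1 := by
  have hsecond : HasFDerivAt (fderiv ℝ φ) (fderiv ℝ (fderiv ℝ φ) z) z :=
    ((hφ.fderiv_right (m := 1) (by norm_num)).differentiableAt (by norm_num)).hasFDerivAt
  have hsymm : fderiv ℝ (fderiv ℝ φ) z (1, 0) (0, w) = fderiv ℝ (fderiv ℝ φ) z (0, w) (1, 0) :=
    hφ.isSymmSndFDerivAt (by simp) _ _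
  have htime : (fun y => fderiv ℝ φ y (1, 0)) =ᶠ[𝓝 z] fun y => v (φ y) := by
    filter_upwards [hφ.eventually (by simp), hflow] with y hy hyflow using
      fderiv_apply_one_zero (hy.differentiableAt (by norm_num)) hyflow
  have hmixed : fderiv ℝ (fderiv ℝ φ) z (0, w) (1, 0) =
      fderiv ℝ v (φ z) (fderiv ℝ φ z (0, w)) := by
    have hφ' := (hφ.differentiableAt (by norm_num)).hasFDerivAt
    have huniq := ((hsecond.clm_apply (hasFDerivAt_const (1, 0) z)).congr_of_eventuallyEq
      htime.symm).unique (hv.hasFDerivAt.comp z hφ')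
    simpa using DFunLike.congr_fun huniq (0, w)
  rw [← hmixed, ← hsymm]
  have hcurve := hsecond.comp_hasDerivAt z.1
    ((hasDerivAt_id z.1).prodMk (hasDerivAt_const z.1 z.2))
  simpa using hcurve.clm_apply (hasDerivAt_const z.1 ((0 : ℝ), w))

/-- In a flow box around `(0, a)`, `t ↦ Dφ_t w` and `t ↦ w ∘ φ_t` solve the same linear equation
`J' = Dv(φ_t) J`, the first by symmetry of the second derivative, the second because `[v, w] = 0`.
-/
theorem fderiv_localFlow_apply_eq {φ : ℝ × E → E} {v w : E → E} {a : E}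
    (hφ : ∀ᶠ z in 𝓝 (0, a), ContDiffAt ℝ 2 φ z ∧ φ (0, z.2) = z.2 ∧
      HasDerivAt (fun t => φ (t, z.2)) (v (φ z)) z.1)
    (hv : ∀ᶠ y in 𝓝 a, ContDiffAt ℝ 1 v y) (hw : ∀ᶠ y in 𝓝 a, DifferentiableAt ℝ w y)
    (hvw : ∀ᶠ y in 𝓝 a, VectorField.lieBracket ℝ v w y = 0) :
    ∀ᶠ z in 𝓝 ((0 : ℝ), a), fderiv ℝ φ z (0, w z.2) = w (φ z) := by
  have hlim : Tendsto φ (𝓝 (0, a)) (𝓝 a) := by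
    simpa only [hφ.self_of_nhds.2.1] using hφ.self_of_nhds.1.continuousAt.tendsto
  have hbound : ∀ᶠ z in 𝓝 ((0 : ℝ), a), ‖fderiv ℝ v (φ z)‖₊ < ‖fderiv ℝ v a‖₊ + 1 :=
    ((hv.self_of_nhds.fderiv_right (m := 0) le_rfl).continuousAt.tendsto.comp hlim).nnnorm
      |>.eventually_lt_const (lt_add_one _)
  obtain ⟨δ, hδ, hball⟩ := Metric.eventually_nhds_iff_ball.1 (hφ.eventually_nhds.and
    ((hlim.eventually (hv.and (hw.and hvw))).and hbound))
  filter_upwards [Metric.ball_mem_nhds _ hδ] with z hz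
  obtain ⟨hzt, hzx⟩ := (ball_prod_same _ _ _).ge hz
  rw [Real.ball_eq_Ioo] at hzt
  have hline : ∀ t ∈ Ioo (0 - δ) (0 + δ), (t, z.2) ∈ Metric.ball ((0 : ℝ), a) δ := fun t ht =>
    (ball_prod_same _ _ _).le ⟨by rwa [Real.ball_eq_Ioo], hzx⟩
  refine ODE_solution_unique_of_mem_Ioo (s := fun _ => univ)
    (v := fun t => fderiv ℝ v (φ (t, z.2))) (K := ‖fderiv ℝ v a‖₊ + 1) (t₀ := 0)
    (f := fun t => fderiv ℝ φ (t, z.2) (0, w z.2)) (g := fun t => w (φ (t, z.2)))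
    (fun t ht => ((fderiv ℝ v (φ (t, z.2))).lipschitz.weaken
      (hball _ (hline t ht)).2.2.le).lipschitzOnWith) ⟨by linarith, by linarith⟩
    (fun t ht => ⟨?_, mem_univ _⟩) (fun t ht => ⟨?_, mem_univ _⟩) ?_ hzt
  · obtain ⟨hflow, ⟨hvt, -⟩, -⟩ := hball _ (hline t ht)
    exact hasDerivAt_fderiv_localFlow hflow.self_of_nhds.1 (hflow.mono fun _ h => h.2.2)
      (hvt.differentiableAt one_ne_zero) (w z.2)
  · obtain ⟨hflow, ⟨-, hwt, hvwt⟩, -⟩ := hball _ (hline t ht)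
    rw [← sub_eq_zero.1 hvwt]
    exact hwt.hasFDerivAt.comp_hasDerivAt t hflow.self_of_nhds.2.2
  · have hinit : (fun y => φ (0, y)) =ᶠ[𝓝 z.2] id := by
      filter_upwards [Metric.isOpen_ball.mem_nhds hzx] with y hy
      have hmem : ((0 : ℝ), y) ∈ Metric.ball ((0 : ℝ), a) δ :=
        (ball_prod_same _ _ _).le ⟨Metric.mem_ball_self hδ, hy⟩
      exact (hball _ hmem).1.self_of_nhds.2.1
    have hφ₀ := (hball _ (hline 0 ⟨by linarith, by linarith⟩)).1.self_of_nhds.1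
    rw [fderiv_zero_apply_of_eventuallyEq (hφ₀.differentiableAt (by norm_num)) hinit]
    exact congrArg w hinit.self_of_nhds.symm

end FlowGerm

section Curve

variable {E F : Type*} [NormedAddCommGroup E] [NormedSpace ℝ E] [NormedAddCommGroup F]
  [NormedSpace ℝ F] {M N : Type*} [TopologicalSpace M] [ChartedSpace E M] [TopologicalSpace N]
  [ChartedSpace F N]

theorem hasMFDerivAt_comp_curve {f : M → N} {γ : ℝ → M} {t : ℝ} {v : TangentSpace 𝓘(ℝ, E) (γ t)}
    (hf : MDifferentiableAt 𝓘(ℝ, E) 𝓘(ℝ, F) f (γ t))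
    (hγ : HasMFDerivAt 𝓘(ℝ, ℝ) 𝓘(ℝ, E) γ t ((1 : ℝ →L[ℝ] ℝ).smulRight v)) :
    HasMFDerivAt 𝓘(ℝ, ℝ) 𝓘(ℝ, F) (fun s => f (γ s)) t
      ((1 : ℝ →L[ℝ] ℝ).smulRight (mfderiv 𝓘(ℝ, E) 𝓘(ℝ, F) f (γ t) v)) := by
  have hspan (L : E →L[ℝ] F) (w : E) := L.comp_toSpanSingleton w
  exact (hf.hasMFDerivAt.comp t hγ).congr_mfderiv (hspan _ v)

end Curve

section ChartFlow

variable {E : Type*} [NormedAddCommGroup E] [NormedSpace ℝ E] {M : Type*} [TopologicalSpace M]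
  [ChartedSpace E M]

/-- The vector field `X` read in the chart at `p`. -/
def chartField (X : (x : M) → TangentSpace 𝓘(ℝ, E) x) (p : M) : E → E :=
  VectorField.mpullback 𝓘(ℝ, E) 𝓘(ℝ, E) (extChartAt 𝓘(ℝ, E) p).symm X

/-- `F` is the flow of `X`, read in the chart at `p`, near time `0` and near the point `p`. -/
def IsChartFlow (X : (x : M) → TangentSpace 𝓘(ℝ, E) x) (p : M) (F : ℝ × E → E) : Prop :=
  ∀ᶠ z in 𝓝 ((0 : ℝ), extChartAt 𝓘(ℝ, E) p p), ContDiffAt ℝ ∞ F z ∧ F (0, z.2) = z.2 ∧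
    HasDerivAt (fun t => F (t, z.2)) (chartField X p (F z)) z.1

variable [IsManifold 𝓘(ℝ, E) ∞ M] {X Y : (x : M) → TangentSpace 𝓘(ℝ, E) x} {p : M} {y : E}

theorem contMDiffAt_extChartAt_symm (hy : y ∈ (extChartAt 𝓘(ℝ, E) p).target) :
    ContMDiffAt 𝓘(ℝ, E) 𝓘(ℝ, E) ∞ (extChartAt 𝓘(ℝ, E) p).symm y :=
  (contMDiffOn_extChartAt_symm p).contMDiffAt ((isOpen_extChartAt_target p).mem_nhds hy)

theorem isInvertible_mfderiv_extChartAt_symm_of_mem (hy : y ∈ (extChartAt 𝓘(ℝ, E) p).target) :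
    (mfderiv 𝓘(ℝ, E) 𝓘(ℝ, E) (extChartAt 𝓘(ℝ, E) p).symm y).IsInvertible := by
  have : IsManifold 𝓘(ℝ, E) 1 M := .of_le (n := ∞) (by simp)
  simpa using isInvertible_mfderivWithin_extChartAt_symm (I := 𝓘(ℝ, E)) hy

theorem mfderiv_extChartAt_symm_chartField (X : (x : M) → TangentSpace 𝓘(ℝ, E) x)
    (hy : y ∈ (extChartAt 𝓘(ℝ, E) p).target) :
    mfderiv 𝓘(ℝ, E) 𝓘(ℝ, E) (extChartAt 𝓘(ℝ, E) p).symm y (chartField X p y : E) =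
      X ((extChartAt 𝓘(ℝ, E) p).symm y) := by
  rw [chartField, VectorField.mpullback_apply]
  exact (isInvertible_mfderiv_extChartAt_symm_of_mem hy).self_apply_inverse _

theorem contDiffAt_chartField [CompleteSpace E]
    (hX : ContMDiff 𝓘(ℝ, E) 𝓘(ℝ, E).tangent ∞ (T% X))
    (hy : y ∈ (extChartAt 𝓘(ℝ, E) p).target) : ContDiffAt ℝ ∞ (chartField X p) y :=
  contMDiffAt_vectorSpace_iff_contDiffAt.1 (ContMDiffAt.mpullback_vectorField_preimage (hX _)
    (contMDiffAt_extChartAt_symm hy) (isInvertible_mfderiv_extChartAt_symm_of_mem hy) (by simp))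

theorem mfderiv_apply_eq_of_chart {f : M → M} {g : E → E}
    (hf : MDifferentiableAt 𝓘(ℝ, E) 𝓘(ℝ, E) f ((extChartAt 𝓘(ℝ, E) p).symm y))
    (hg : DifferentiableAt ℝ g y) (hy : y ∈ (extChartAt 𝓘(ℝ, E) p).target)
    (hgy : g y ∈ (extChartAt 𝓘(ℝ, E) p).target)
    (hfg : f ∘ (extChartAt 𝓘(ℝ, E) p).symm =ᶠ[𝓝 y] (extChartAt 𝓘(ℝ, E) p).symm ∘ g)
    (hinvariant : fderiv ℝ g y (chartField X p y) = chartField X p (g y)) :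
    mfderiv 𝓘(ℝ, E) 𝓘(ℝ, E) f ((extChartAt 𝓘(ℝ, E) p).symm y)
      (X ((extChartAt 𝓘(ℝ, E) p).symm y)) = X (f ((extChartAt 𝓘(ℝ, E) p).symm y)) := by
  have hsymm := (contMDiffAt_extChartAt_symm hy).mdifferentiableAt (by simp)
  have hsymm' := (contMDiffAt_extChartAt_symm hgy).mdifferentiableAt (by simp)
  have hleft := (mfderiv_comp_apply y hf hsymm (chartField X p y : E)).trans
    (congrArg _ (mfderiv_extChartAt_symm_chartField X hy))
  have hg' : mfderiv 𝓘(ℝ, E) 𝓘(ℝ, E) g y (chartField X p y : E) = chartField X p (g y) := by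
    rwa [mfderiv_eq_fderiv]
  have hright := ((mfderiv_comp_apply y hsymm' hg.mdifferentiableAt (chartField X p y : E)).trans
    (congrArg _ hg')).trans (mfderiv_extChartAt_symm_chartField X hgy)
  rw [hfg.mfderiv_eq] at hleft
  exact (hleft.symm.trans hright).trans (congrArg (fun x => (X x : E)) hfg.self_of_nhds.symm)

theorem lieBracket_chartField [CompleteSpace E]
    (hX : ContMDiff 𝓘(ℝ, E) 𝓘(ℝ, E).tangent ∞ (T% X))
    (hY : ContMDiff 𝓘(ℝ, E) 𝓘(ℝ, E).tangent ∞ (T% Y))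
    (hy : y ∈ (extChartAt 𝓘(ℝ, E) p).target) :
    VectorField.lieBracket ℝ (chartField X p) (chartField Y p) y =
      chartField (VectorField.mlieBracket 𝓘(ℝ, E) X Y) p y := by
  have hle : minSmoothness ℝ 2 ≤ (∞ : ℕ∞ω) := by
    rw [minSmoothness_of_isRCLikeNormedField]
    exact WithTop.coe_le_coe.2 le_top
  have : IsManifold 𝓘(ℝ, E) (minSmoothness ℝ 2) M := .of_le (n := ∞) hle
  rw [chartField, chartField, chartField, VectorField.mpullback_mlieBracket (n := ∞)
    ((hX _).mdifferentiableAt (by simp)) ((hY _).mdifferentiableAt (by simp))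
    (contMDiffAt_extChartAt_symm hy) hle, ← VectorField.mlieBracketWithin_univ,
    VectorField.mlieBracketWithin_eq_lieBracketWithin]
  exact congrFun VectorField.lieBracketWithin_univ.symm y

theorem exists_isChartFlow [FiniteDimensional ℝ E]
    (hX : ContMDiff 𝓘(ℝ, E) 𝓘(ℝ, E).tangent ∞ (T% X)) (p : M) :
    ∃ F : ℝ × E → E, IsChartFlow X p F := by
  have : CompleteSpace E := FiniteDimensional.complete ℝ E
  exact exists_contDiffAt_localFlow <| by
    filter_upwards [extChartAt_target_mem_nhds p] with y hy using contDiffAt_chartField hX hy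

namespace IsChartFlow

variable {F : ℝ × E → E}

omit [IsManifold 𝓘(ℝ, E) ∞ M] in
theorem tendsto (hF : IsChartFlow X p F) : Tendsto F (𝓝 (0, extChartAt 𝓘(ℝ, E) p p))
    (𝓝 (extChartAt 𝓘(ℝ, E) p p)) := by
  simpa only [hF.self_of_nhds.2.1] using hF.self_of_nhds.1.continuousAt.tendsto

theorem exists_isMIntegralCurveOn (hF : IsChartFlow X p F) : ∃ ε > 0, ∀ᶠ q in 𝓝 p,
    (extChartAt 𝓘(ℝ, E) p).symm (F (0, extChartAt 𝓘(ℝ, E) p q)) = q ∧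
    IsMIntegralCurveOn (fun t => (extChartAt 𝓘(ℝ, E) p).symm (F (t, extChartAt 𝓘(ℝ, E) p q)))
      X (Ioo (-ε) ε) := by
  have hbox := Filter.Eventually.and hF (hF.tendsto.eventually (extChartAt_target_mem_nhds p))
  rw [nhds_prod_eq, eventually_prod_iff] at hbox
  obtain ⟨A, hA, B, hB, hAB⟩ := hbox
  obtain ⟨ε, hε, hεA⟩ := Metric.eventually_nhds_iff_ball.1 hA
  refine ⟨ε, hε, ?_⟩
  filter_upwards [(continuousAt_extChartAt p).eventually hB,
    extChartAt_source_mem_nhds (I := 𝓘(ℝ, E)) p] with q hq hqsource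
  refine ⟨?_, fun t ht => ?_⟩
  · rw [(hAB (hεA 0 (Metric.mem_ball_self hε)) hq).1.2.1, PartialEquiv.left_inv _ hqsource]
  · have htball : t ∈ Metric.ball 0 ε := by rwa [Real.ball_eq_Ioo, zero_sub, zero_add]
    obtain ⟨⟨-, -, hderiv⟩, htarget⟩ := hAB (hεA t htball) hq
    have hsymm := (contMDiffAt_extChartAt_symm htarget).mdifferentiableAt (by simp)
    rw [← mfderiv_extChartAt_symm_chartField X htarget]
    exact (hasMFDerivAt_comp_curve hsymm hderiv.hasFDerivAt.hasMFDerivAt).hasMFDerivWithinAt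

end IsChartFlow

end ChartFlow

section GlobalFlow

theorem forall_of_eventually_iff {X : Type*} [TopologicalSpace X] [PreconnectedSpace X]
    {P : X → Prop} (hP : ∀ x, ∀ᶠ y in 𝓝 x, P y ↔ P x) {x₀ : X} (h₀ : P x₀) (x : X) : P x := by
  have hlocal : IsLocallyConstant P := (IsLocallyConstant.iff_eventually_eq P).2 fun x =>
    (hP x).mono fun y hy => propext hy
  exact (hlocal.apply_eq_of_preconnectedSpace x x₀).mpr h₀

variable {E : Type*} [NormedAddCommGroup E] [NormedSpace ℝ E] {M : Type*} [TopologicalSpace M]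
  [ChartedSpace E M]

theorem tendsto_prodMk_extChartAt (p : M) :
    Tendsto (fun z : ℝ × M => (z.1, extChartAt 𝓘(ℝ, E) p z.2)) (𝓝 (0, p))
      (𝓝 (0, extChartAt 𝓘(ℝ, E) p p)) :=
  continuousAt_fst.prodMk ((continuousAt_extChartAt p).comp (x := ((0 : ℝ), p)) continuousAt_snd)

theorem IsChartFlow.eventually_fderiv_apply_chartField [IsManifold 𝓘(ℝ, E) ∞ M]
    [FiniteDimensional ℝ E] {X Y : (x : M) → TangentSpace 𝓘(ℝ, E) x} {p : M} {F : ℝ × E → E}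
    (hF : IsChartFlow X p F) (hX : ContMDiff 𝓘(ℝ, E) 𝓘(ℝ, E).tangent ∞ (T% X))
    (hY : ContMDiff 𝓘(ℝ, E) 𝓘(ℝ, E).tangent ∞ (T% Y))
    (hXY : ∀ x, VectorField.mlieBracket 𝓘(ℝ, E) X Y x = 0) :
    ∀ᶠ z in 𝓝 ((0 : ℝ), extChartAt 𝓘(ℝ, E) p p),
      fderiv ℝ F z (0, chartField Y p z.2) = chartField Y p (F z) := by
  have : CompleteSpace E := FiniteDimensional.complete ℝ E
  have htarget := extChartAt_target_mem_nhds (I := 𝓘(ℝ, E)) p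
  refine fderiv_localFlow_apply_eq (v := chartField X p)
    (hF.mono fun z hz => ⟨hz.1.of_le (WithTop.coe_le_coe.2 le_top), hz.2⟩) ?_ ?_ ?_
  · filter_upwards [htarget] with y hy using (contDiffAt_chartField hX hy).of_le (by simp)
  · filter_upwards [htarget] with y hy
      using (contDiffAt_chartField hY hy).differentiableAt (by simp)
  · filter_upwards [htarget] with y hy
    rw [lieBracket_chartField hX hY hy, chartField, VectorField.mpullback_apply, hXY]
    exact map_zero _

/-- `φ` is the global flow of the vector field `X`. -/
structure IsFlow (X : (x : M) → TangentSpace 𝓘(ℝ, E) x) (φ : ℝ → M → M) : Prop where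
  zero_apply : ∀ p, φ 0 p = p
  isMIntegralCurve : ∀ p, IsMIntegralCurve (fun t => φ t p) X

namespace IsFlow

variable {X Y : (x : M) → TangentSpace 𝓘(ℝ, E) x} {φ ψ : ℝ → M → M} {p : M} {F : ℝ × E → E}

theorem continuous_apply (hφ : IsFlow X φ) (p : M) : Continuous fun t => φ t p :=
  continuous_iff_continuousAt.2 fun t => (hφ.isMIntegralCurve p t).continuousAt

theorem forall_of_eventually_of_add (hφ : IsFlow X φ) {P : ℝ → M → Prop}
    (hlocal : ∀ p, ∀ᶠ z in 𝓝 ((0 : ℝ), p), P z.1 z.2)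
    (hadd : ∀ s t p, P s (φ t p) → P t p → P (s + t) p) (t : ℝ) (p : M) : P t p := by
  refine forall_of_eventually_iff (P := fun t => P t p) (fun t => ?_) (x₀ := 0)
    (hlocal p).self_of_nhds t
  have hforth : Tendsto (fun s => (s - t, φ t p)) (𝓝 t) (𝓝 (0, φ t p)) := by
    have hcont : Continuous fun s => (s - t, φ t p) := by fun_prop
    simpa only [sub_self] using hcont.tendsto t
  have hback : Tendsto (fun s => (t - s, φ s p)) (𝓝 t) (𝓝 (0, φ t p)) := by
    have hcont : Continuous fun s => (t - s, φ s p) :=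
      (continuous_const.sub continuous_id).prodMk (hφ.continuous_apply p)
    simpa only [sub_self] using hcont.tendsto t
  filter_upwards [hforth.eventually (hlocal (φ t p)), hback.eventually (hlocal (φ t p))]
    with s hs ht
  exact ⟨fun h => by simpa using hadd _ _ _ ht h, fun h => by simpa using hadd _ _ _ hs h⟩

variable [IsManifold 𝓘(ℝ, E) ∞ M] [T2Space M]

section LocalFlow

variable (hX : ContMDiff 𝓘(ℝ, E) 𝓘(ℝ, E).tangent ∞ (T% X))
include hX

theorem eq_apply (hφ : IsFlow X φ) {γ : ℝ → M} (hγ : IsMIntegralCurve γ X) (t : ℝ) :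
    γ t = φ t (γ 0) := by
  have : IsManifold 𝓘(ℝ, E) 1 M := .of_le (n := ∞) (by simp)
  exact congrFun (isMIntegralCurve_Ioo_eq_of_contMDiff_boundaryless (t₀ := 0)
    (hX.of_le (by simp)) hγ (hφ.isMIntegralCurve (γ 0)) (hφ.zero_apply _).symm) t

theorem add_apply (hφ : IsFlow X φ) (s t : ℝ) (p : M) : φ (s + t) p = φ s (φ t p) := by
  simpa using hφ.eq_apply hX ((hφ.isMIntegralCurve p).comp_add t) s

theorem eventually_eq_chartFlow (hφ : IsFlow X φ) (hF : IsChartFlow X p F) :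
    ∀ᶠ z in 𝓝 ((0 : ℝ), p), φ z.1 z.2 =
      (extChartAt 𝓘(ℝ, E) p).symm (F (z.1, extChartAt 𝓘(ℝ, E) p z.2)) := by
  have : IsManifold 𝓘(ℝ, E) 1 M := .of_le (n := ∞) (by simp)
  obtain ⟨ε, hε, hcurve⟩ := hF.exists_isMIntegralCurveOn
  have htime : ∀ᶠ z in 𝓝 ((0 : ℝ), p), z.1 ∈ Ioo (-ε) ε :=
    continuousAt_fst.eventually (Ioo_mem_nhds (neg_lt_zero.2 hε) hε)
  filter_upwards [htime, continuousAt_snd.eventually hcurve] with z ht ⟨hinit, hz⟩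
  refine isMIntegralCurveOn_Ioo_eqOn_of_contMDiff_boundaryless (t₀ := 0)
    ⟨neg_lt_zero.2 hε, hε⟩ (hX.of_le (by simp)) ((hφ.isMIntegralCurve z.2).isMIntegralCurveOn _)
    hz ?_ ht
  rw [hφ.zero_apply, hinit]

end LocalFlow

section FiniteDimensional

variable [FiniteDimensional ℝ E] (hX : ContMDiff 𝓘(ℝ, E) 𝓘(ℝ, E).tangent ∞ (T% X))
include hX

theorem eventually_contMDiffAt (hφ : IsFlow X φ) (p : M) : ∀ᶠ z in 𝓝 ((0 : ℝ), p),
    ContMDiffAt (𝓘(ℝ, ℝ).prod 𝓘(ℝ, E)) 𝓘(ℝ, E) ∞ (fun z : ℝ × M => φ z.1 z.2) z := by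
  obtain ⟨F, hF⟩ := exists_isChartFlow hX p
  filter_upwards [(hφ.eventually_eq_chartFlow hX hF).eventually_nhds,
    (tendsto_prodMk_extChartAt p).eventually (Filter.Eventually.and hF
      (hF.tendsto.eventually (extChartAt_target_mem_nhds p))),
    continuousAt_snd.eventually (extChartAt_source_mem_nhds (I := 𝓘(ℝ, E)) p)]
    with z heq ⟨⟨hsmooth, _⟩, htarget⟩ hsource
  refine ContMDiffAt.congr_of_eventuallyEq ?_ heq
  have hchart' : ContMDiffAt (𝓘(ℝ, ℝ).prod 𝓘(ℝ, E)) 𝓘(ℝ, ℝ × E) ∞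
      (fun z : ℝ × M => (z.1, extChartAt 𝓘(ℝ, E) p z.2)) z :=
    contMDiffAt_fst.prodMk_space ((contMDiffAt_extChartAt'
      (by rwa [← extChartAt_source 𝓘(ℝ, E)])).comp z contMDiffAt_snd)
  exact (contMDiffAt_extChartAt_symm htarget).comp z (hsmooth.contMDiffAt.comp z hchart')

theorem contMDiff (hφ : IsFlow X φ) :
    ContMDiff (𝓘(ℝ, ℝ).prod 𝓘(ℝ, E)) 𝓘(ℝ, E) ∞ fun z : ℝ × M => φ z.1 z.2 := by
  rintro ⟨t, p⟩
  refine hφ.forall_of_eventually_of_add (P := fun t p =>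
    ContMDiffAt (𝓘(ℝ, ℝ).prod 𝓘(ℝ, E)) 𝓘(ℝ, E) ∞ (fun z : ℝ × M => φ z.1 z.2) (t, p))
    (hφ.eventually_contMDiffAt hX) (fun s t p hs ht => ?_) t p
  have hshift : ContMDiffAt (𝓘(ℝ, ℝ).prod 𝓘(ℝ, E)) (𝓘(ℝ, ℝ).prod 𝓘(ℝ, E)) ∞
      (fun z : ℝ × M => (z.1 - t, φ t z.2)) (s + t, p) :=
    (contMDiffAt_fst.sub contMDiffAt_const).prodMk
      (ContMDiffAt.comp (g := fun z : ℝ × M => φ z.1 z.2) (f := fun z : ℝ × M => (t, z.2))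
        (s + t, p) ht (contMDiffAt_const.prodMk contMDiffAt_snd))
  have hs' : ContMDiffAt (𝓘(ℝ, ℝ).prod 𝓘(ℝ, E)) 𝓘(ℝ, E) ∞ (fun z : ℝ × M => φ z.1 z.2)
    (s + t - t, φ t p) := by rwa [add_sub_cancel_right]
  refine (hs'.comp (s + t, p) hshift).congr_of_eventuallyEq (.of_forall fun z => ?_)
  rw [Function.comp_apply, ← hφ.add_apply hX, sub_add_cancel]

theorem contMDiff_apply (hφ : IsFlow X φ) (t : ℝ) : ContMDiff 𝓘(ℝ, E) 𝓘(ℝ, E) ∞ (φ t) :=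
  (hφ.contMDiff hX).comp (contMDiff_const.prodMk contMDiff_id)

theorem eventually_mfderiv_apply (hφ : IsFlow X φ)
    (hY : ContMDiff 𝓘(ℝ, E) 𝓘(ℝ, E).tangent ∞ (T% Y))
    (hXY : ∀ x, VectorField.mlieBracket 𝓘(ℝ, E) X Y x = 0) (p : M) :
    ∀ᶠ z in 𝓝 ((0 : ℝ), p), mfderiv 𝓘(ℝ, E) 𝓘(ℝ, E) (φ z.1) z.2 (Y z.2) = Y (φ z.1 z.2) := by
  obtain ⟨F, hF⟩ := exists_isChartFlow hX p
  filter_upwards [(hφ.eventually_eq_chartFlow hX hF).eventually_nhds,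
    (tendsto_prodMk_extChartAt p).eventually ((hF.eventually_fderiv_apply_chartField hX hY hXY).and
      (Filter.Eventually.and hF (hF.tendsto.eventually (extChartAt_target_mem_nhds p)))),
    continuousAt_snd.eventually (extChartAt_source_mem_nhds (I := 𝓘(ℝ, E)) p)]
    with ⟨t, q⟩ heq ⟨hfderiv, ⟨hsmooth, _⟩, hmem⟩ (hsource : q ∈ (extChartAt 𝓘(ℝ, E) p).source)
  set y := extChartAt 𝓘(ℝ, E) p q
  have hy := PartialEquiv.map_source _ hsource
  have hq : (extChartAt 𝓘(ℝ, E) p).symm y = q := PartialEquiv.left_inv _ hsource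
  have hslice : Tendsto (fun y' => (t, (extChartAt 𝓘(ℝ, E) p).symm y')) (𝓝 y) (𝓝 (t, q)) :=
    tendsto_const_nhds.prodMk_nhds
      (hq ▸ (contMDiffAt_extChartAt_symm hy).continuousAt.tendsto)
  rw [← hq]
  refine mfderiv_apply_eq_of_chart (g := fun y => F (t, y))
    ((hφ.contMDiff_apply hX t _).mdifferentiableAt (by simp))
    ((hsmooth.differentiableAt (by simp)).comp y (by fun_prop)) hy hmem ?_ ?_
  · filter_upwards [hslice.eventually heq, (isOpen_extChartAt_target p).mem_nhds hy]
      with y' hflow hy'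
    rw [Function.comp_apply, Function.comp_apply, hflow, PartialEquiv.right_inv _ hy']
  · rw [← hfderiv]
    exact congrArg (· (chartField Y p y)) ((hsmooth.differentiableAt
      (by simp)).hasFDerivAt.comp y (hasFDerivAt_prodMk_right t y)).fderiv

theorem mfderiv_apply (hφ : IsFlow X φ) (hY : ContMDiff 𝓘(ℝ, E) 𝓘(ℝ, E).tangent ∞ (T% Y))
    (hXY : ∀ x, VectorField.mlieBracket 𝓘(ℝ, E) X Y x = 0) (t : ℝ) (p : M) :
    mfderiv 𝓘(ℝ, E) 𝓘(ℝ, E) (φ t) p (Y p) = Y (φ t p) := by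
  refine hφ.forall_of_eventually_of_add
    (P := fun t p => mfderiv 𝓘(ℝ, E) 𝓘(ℝ, E) (φ t) p (Y p) = Y (φ t p))
    (hφ.eventually_mfderiv_apply hX hY hXY) (fun s t p hs ht => ?_) t p
  have hdiff (r : ℝ) (q : M) : MDifferentiableAt 𝓘(ℝ, E) 𝓘(ℝ, E) (φ r) q :=
    (hφ.contMDiff_apply hX r q).mdifferentiableAt (by simp)
  have hadd : φ (s + t) = φ s ∘ φ t := funext fun q => hφ.add_apply hX s t q
  rw [hadd, mfderiv_comp_apply p (hdiff s _) (hdiff t p), ht, hs, Function.comp_apply]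

theorem commute (hφ : IsFlow X φ) (hψ : IsFlow Y ψ)
    (hY : ContMDiff 𝓘(ℝ, E) 𝓘(ℝ, E).tangent ∞ (T% Y))
    (hXY : ∀ x, VectorField.mlieBracket 𝓘(ℝ, E) X Y x = 0) (s t : ℝ) (p : M) :
    φ s (ψ t p) = ψ t (φ s p) := by
  have hcurve : IsMIntegralCurve (fun t => φ s (ψ t p)) Y := fun t => by
    rw [← hφ.mfderiv_apply hX hY hXY]
    exact hasMFDerivAt_comp_curve ((hφ.contMDiff_apply hX s _).mdifferentiableAt (by simp))
      (hψ.isMIntegralCurve p t)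
  simpa only [hψ.zero_apply] using hψ.eq_apply hY hcurve t

end FiniteDimensional

end IsFlow

end GlobalFlow

theorem eventually_ne_of_hasMFDerivAt_injective {V E : Type*} [NormedAddCommGroup V]
    [NormedSpace ℝ V] [FiniteDimensional ℝ V] [NormedAddCommGroup E] [NormedSpace ℝ E]
    {M : Type*} [TopologicalSpace M] [ChartedSpace E M] {f : V → M} {v : V}
    {L : V →L[ℝ] E} (hf : HasMFDerivAt 𝓘(ℝ, V) 𝓘(ℝ, E) f v L)
    (hL : Function.Injective L) : ∀ᶠ w in 𝓝[≠] v, f w ≠ f v := by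
  obtain ⟨K, -, hK⟩ := (LinearMap.injective_iff_antilipschitz (L : V →ₗ[ℝ] E)).1 hL
  have hchart : HasFDerivAt (extChartAt 𝓘(ℝ, E) (f v) ∘ f) L v := by
    rw [← hasFDerivWithinAt_univ, ← range_id]
    exact hf.2
  filter_upwards [hchart.eventually_ne (c := extChartAt 𝓘(ℝ, E) (f v) (f v)) ⟨K, hK⟩] with w hw h
  exact hw (congrArg (extChartAt 𝓘(ℝ, E) (f v)) h)

section SmoothAction

/-- The infinitesimal action at `p` of a vector group `V` acting on a manifold modelled on `E`: the
derivative at `0` of the orbit map `v ↦ v +ᵥ p`. -/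
def infinitesimalVAdd (V E : Type*) [NormedAddCommGroup V] [NormedSpace ℝ V] [NormedAddCommGroup E]
    [NormedSpace ℝ E] {M : Type*} [TopologicalSpace M] [ChartedSpace E M] [AddAction V M] (p : M) :
    V →L[ℝ] TangentSpace 𝓘(ℝ, E) p :=
  (mfderiv 𝓘(ℝ, V) 𝓘(ℝ, E) (fun v : V => v +ᵥ p) 0 : V →L[ℝ] E)

variable {V : Type*} [NormedAddCommGroup V] [NormedSpace ℝ V] {E : Type*} [NormedAddCommGroup E]
  [NormedSpace ℝ E] {M : Type*} [TopologicalSpace M] [ChartedSpace E M] [AddAction V M]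

section Derivative

variable [ContMDiffVAdd 𝓘(ℝ, V) 𝓘(ℝ, E) ∞ V M]

theorem contMDiff_vadd_point (p : M) : ContMDiff 𝓘(ℝ, V) 𝓘(ℝ, E) ∞ fun v : V => v +ᵥ p :=
  (ContMDiffVAdd.contMDiff_vadd (I := 𝓘(ℝ, V))).comp (contMDiff_id.prodMk contMDiff_const)

theorem contMDiff_vadd_vector (v : V) : ContMDiff 𝓘(ℝ, E) 𝓘(ℝ, E) ∞ fun p : M => v +ᵥ p :=
  (ContMDiffVAdd.contMDiff_vadd (I := 𝓘(ℝ, V))).comp (contMDiff_const.prodMk contMDiff_id)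

theorem hasMFDerivAt_vadd_point_zero (p : M) :
    HasMFDerivAt 𝓘(ℝ, V) 𝓘(ℝ, E) (fun w : V => w +ᵥ p) 0 (infinitesimalVAdd V E p) :=
  ((contMDiff_vadd_point p).mdifferentiable (by simp) 0).hasMFDerivAt

theorem hasMFDerivAt_vadd_point (v : V) (p : M) :
    HasMFDerivAt 𝓘(ℝ, V) 𝓘(ℝ, E) (fun w : V => w +ᵥ p) v (infinitesimalVAdd V E (v +ᵥ p)) := by
  have horbit : HasMFDerivAt 𝓘(ℝ, V) 𝓘(ℝ, E) (fun w : V => w +ᵥ (v +ᵥ p)) (v - v)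
      (infinitesimalVAdd V E (v +ᵥ p)) := by
    rw [sub_self]
    exact hasMFDerivAt_vadd_point_zero (v +ᵥ p)
  have hshift : HasMFDerivAt 𝓘(ℝ, V) 𝓘(ℝ, V) (fun w : V => w - v) v (.id ℝ V) :=
    ((hasFDerivAt_id v).sub_const v).hasMFDerivAt
  refine ((HasMFDerivAt.comp (f := fun w => w - v) v horbit hshift).congr_of_eventuallyEq
    (.of_forall fun w => ?_)).congr_mfderiv ?_
  · rw [Function.comp_apply, vadd_vadd, sub_add_cancel]
  · exact ContinuousLinearMap.comp_id _

theorem mfderiv_vadd_vector (v w : V) (p : M) :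
    mfderiv 𝓘(ℝ, E) 𝓘(ℝ, E) (fun q : M => v +ᵥ q) p (infinitesimalVAdd V E p w) =
      infinitesimalVAdd V E (v +ᵥ p) w := by
  have hvector : MDifferentiableAt 𝓘(ℝ, E) 𝓘(ℝ, E) (fun q : M => v +ᵥ q) ((0 : V) +ᵥ p) :=
    (contMDiff_vadd_vector v).mdifferentiable (by simp) _
  have hcomp := mfderiv_comp (0 : V) hvector
    ((contMDiff_vadd_point (E := E) p).mdifferentiable (by simp) 0)
  rw [zero_vadd] at hcomp
  have hcomm : (fun q : M => v +ᵥ q) ∘ (fun u : V => u +ᵥ p) = fun u => u +ᵥ (v +ᵥ p) :=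
    funext fun u => vadd_comm v u p
  rw [hcomm] at hcomp
  exact congrArg (fun L : V →L[ℝ] E => L w) hcomp.symm

variable [FiniteDimensional ℝ V] {p : M} (hinj : Function.Injective (infinitesimalVAdd V E p))
include hinj

theorem eventually_vadd_ne : ∀ᶠ v : V in 𝓝[≠] 0, v +ᵥ p ≠ p := by
  have hne := eventually_ne_of_hasMFDerivAt_injective (E := E)
    (hasMFDerivAt_vadd_point_zero p) hinj
  simpa only [zero_vadd] using hne

theorem exists_injOn_vadd_point : ∃ δ > 0, InjOn (fun v : V => v +ᵥ p) (Metric.ball 0 δ) := by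
  obtain ⟨δ, hδ, hball⟩ := Metric.mem_nhdsWithin_iff.1 (eventually_vadd_ne hinj)
  refine ⟨δ / 2, half_pos hδ, fun v hv w hw (hvw : v +ᵥ p = w +ᵥ p) => ?_⟩
  by_contra hne
  have hmem : -w + v ∈ Metric.ball 0 δ := by
    rw [mem_ball_zero_iff] at hv hw ⊢
    linarith [norm_add_le (-w) v, norm_neg w]
  have hzero : -w + v ≠ 0 := fun h => hne (neg_add_eq_zero.1 h).symm
  exact hball ⟨hmem, hzero⟩ (by rw [add_vadd, hvw, neg_vadd_vadd])

theorem discreteTopology_stabilizer : DiscreteTopology (AddAction.stabilizer V p) := by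
  obtain ⟨U, hU, hUo, hzero⟩ := eventually_nhds_iff.1
    (eventually_nhdsWithin_iff.1 (eventually_vadd_ne hinj))
  refine discreteTopology_of_isOpen_singleton_zero
    ((isOpen_induced_iff.2 ⟨U, hUo, Subset.antisymm ?_ ?_⟩))
  · exact fun v hv => by_contra fun hne => hU v hv (fun h => hne (Subtype.ext h)) v.2
  · rintro _ rfl
    exact hzero

end Derivative

end SmoothAction

section OrbitCurve

variable {V : Type*} [NormedAddCommGroup V] [NormedSpace ℝ V] {E : Type*} [NormedAddCommGroup E]
  [NormedSpace ℝ E] {M : Type*} [TopologicalSpace M] [ChartedSpace E M] [AddAction V M]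
  [ContMDiffVAdd 𝓘(ℝ, V) 𝓘(ℝ, E) ∞ V M]

theorem hasMFDerivAt_vadd_curve {A : ℝ → V} {γ : ℝ → M} {t : ℝ} {a w : V} (hA : HasDerivAt A a t)
    (hγ : HasMFDerivAt 𝓘(ℝ, ℝ) 𝓘(ℝ, E) γ t
      ((1 : ℝ →L[ℝ] ℝ).smulRight (infinitesimalVAdd V E (γ t) w))) :
    HasMFDerivAt 𝓘(ℝ, ℝ) 𝓘(ℝ, E) (fun s => A s +ᵥ γ s) t
      ((1 : ℝ →L[ℝ] ℝ).smulRight (infinitesimalVAdd V E (A t +ᵥ γ t) (a + w))) := by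
  have hvadd : MDifferentiableAt (𝓘(ℝ, V).prod 𝓘(ℝ, E)) 𝓘(ℝ, E) (fun z : V × M => z.1 +ᵥ z.2)
      (A t, γ t) :=
    (ContMDiffVAdd.contMDiff_vadd (I := 𝓘(ℝ, V)) (n := ∞)).mdifferentiable (by simp) _
  refine (hvadd.hasMFDerivAt.comp t (hA.hasFDerivAt.hasMFDerivAt.prodMk hγ)).congr_mfderiv ?_
  ext
  refine (mfderiv_prod_eq_add_apply hvadd).trans ?_
  have hpoint : mfderiv 𝓘(ℝ, V) 𝓘(ℝ, E) (fun v : V => v +ᵥ γ t) (A t) ((1 : ℝ) • a : V) =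
      infinitesimalVAdd V E (A t +ᵥ γ t) a := by
    rw [one_smul]
    exact congrArg (fun L : V →L[ℝ] E => L a) (hasMFDerivAt_vadd_point (A t) (γ t)).mfderiv
  have hvector : mfderiv 𝓘(ℝ, E) 𝓘(ℝ, E) (fun p : M => A t +ᵥ p) (γ t)
      ((1 : ℝ) • infinitesimalVAdd V E (γ t) w) = infinitesimalVAdd V E (A t +ᵥ γ t) w := by
    rw [one_smul, mfderiv_vadd_vector]
  refine (congrArg₂ (fun u v : E => u + v) hpoint hvector).trans ?_
  exact (map_add _ a w).symm.trans (one_smul ℝ _).symm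

variable [CompleteSpace V] [IsManifold 𝓘(ℝ, E) ∞ M] [T2Space M]

theorem mem_orbit_of_forall_hasMFDerivAt {γ : ℝ → M} {a : ℝ → V} (ha : Continuous a)
    (hγ : ∀ t, HasMFDerivAt 𝓘(ℝ, ℝ) 𝓘(ℝ, E) γ t
      ((1 : ℝ →L[ℝ] ℝ).smulRight (infinitesimalVAdd V E (γ t) (a t)))) (t : ℝ) :
    γ t ∈ AddAction.orbit V (γ 0) := by
  have : IsManifold 𝓘(ℝ, E) 1 M := .of_le (n := ∞) (by simp)
  let A : ℝ → V := fun s => ∫ r in (0 : ℝ)..s, a r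
  have hA (s : ℝ) : HasDerivAt (fun r => -A r) (-a s) s :=
    (ha.integral_hasStrictDerivAt 0 s).hasDerivAt.neg
  have hconst : IsMIntegralCurve (fun s => -A s +ᵥ γ s)
      (fun x => (0 : TangentSpace 𝓘(ℝ, E) x)) := fun s => by
    simpa only [neg_add_cancel, map_zero] using hasMFDerivAt_vadd_curve (hA s) (hγ s)
  have hrest : IsMIntegralCurve (fun _ : ℝ => γ 0) (fun x => (0 : TangentSpace 𝓘(ℝ, E) x)) :=
    fun s => by
      refine (hasMFDerivAt_const (γ 0) s).congr_mfderiv ?_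
      ext
      exact (smul_zero (A := E) (1 : ℝ)).symm
  have heq := congrFun (isMIntegralCurve_Ioo_eq_of_contMDiff_boundaryless (t₀ := 0)
    (Bundle.contMDiff_zeroSection ℝ (TangentSpace 𝓘(ℝ, E))) hconst hrest (by simp [A])) t
  exact ⟨A t, by simp [← heq]⟩

end OrbitCurve

section FlowAction

theorem vadd_eq_fst_vadd_snd_vadd {M : Type*} [AddAction (ℝ × ℝ) M] (v : ℝ × ℝ) (p : M) :
    v +ᵥ p = ((v.1, 0) : ℝ × ℝ) +ᵥ (((0, v.2) : ℝ × ℝ) +ᵥ p) := by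
  rw [vadd_vadd, Prod.mk_add_mk, add_zero, zero_add]

theorem infinitesimalVAdd_vadd_apply_eq {V E : Type*} [NormedAddCommGroup V] [NormedSpace ℝ V]
    [NormedAddCommGroup E] [NormedSpace ℝ E] {M : Type*} [TopologicalSpace M] [ChartedSpace E M]
    [AddAction V M] [ContMDiffVAdd 𝓘(ℝ, V) 𝓘(ℝ, E) ∞ V M] {A : ℝ → V} {a : V} {t : ℝ} {p : M}
    {x : TangentSpace 𝓘(ℝ, E) (A t +ᵥ p)} (hA : HasDerivAt A a t)
    (hx : HasMFDerivAt 𝓘(ℝ, ℝ) 𝓘(ℝ, E) (fun s => A s +ᵥ p) t ((1 : ℝ →L[ℝ] ℝ).smulRight x)) :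
    infinitesimalVAdd V E (A t +ᵥ p) a = x := by
  have hunique := hasMFDerivAt_unique
    ((hasMFDerivAt_vadd_point (A t) p).comp t hA.hasFDerivAt.hasMFDerivAt) hx
  have happly : infinitesimalVAdd V E (A t +ᵥ p) ((1 : ℝ) • a) = (1 : ℝ) • x :=
    congrArg (fun L : ℝ →L[ℝ] E => L 1) hunique
  simpa only [one_smul] using happly

variable {E : Type*} [NormedAddCommGroup E] [NormedSpace ℝ E] {M : Type*} [TopologicalSpace M]
  [ChartedSpace E M] {X Y : (x : M) → TangentSpace 𝓘(ℝ, E) x}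

theorem infinitesimalVAdd_of_isFlow [AddAction (ℝ × ℝ) M]
    [ContMDiffVAdd 𝓘(ℝ, ℝ × ℝ) 𝓘(ℝ, E) ∞ (ℝ × ℝ) M]
    (hfst : IsFlow X fun t p => ((t, 0) : ℝ × ℝ) +ᵥ p)
    (hsnd : IsFlow Y fun t p => ((0, t) : ℝ × ℝ) +ᵥ p) (p : M) (w : ℝ × ℝ) :
    infinitesimalVAdd (ℝ × ℝ) E p w = w.1 • X p + w.2 • Y p := by
  have hX : infinitesimalVAdd (ℝ × ℝ) E p (1, 0) = X p := by
    have hp : infinitesimalVAdd (ℝ × ℝ) E ((0 : ℝ × ℝ) +ᵥ p) (1, 0) = X ((0 : ℝ × ℝ) +ᵥ p) :=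
      infinitesimalVAdd_vadd_apply_eq (A := fun t => (t, 0))
        ((hasDerivAt_id (0 : ℝ)).prodMk (hasDerivAt_const (0 : ℝ) (0 : ℝ)))
        (hfst.isMIntegralCurve p 0)
    rwa [zero_vadd] at hp
  have hY : infinitesimalVAdd (ℝ × ℝ) E p (0, 1) = Y p := by
    have hp : infinitesimalVAdd (ℝ × ℝ) E ((0 : ℝ × ℝ) +ᵥ p) (0, 1) = Y ((0 : ℝ × ℝ) +ᵥ p) :=
      infinitesimalVAdd_vadd_apply_eq (A := fun t => (0, t))
        ((hasDerivAt_const (0 : ℝ) (0 : ℝ)).prodMk (hasDerivAt_id (0 : ℝ)))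
        (hsnd.isMIntegralCurve p 0)
    rwa [zero_vadd] at hp
  rw [← hX, ← hY, ← map_smul, ← map_smul, ← map_add]
  simp

variable [FiniteDimensional ℝ E] [IsManifold 𝓘(ℝ, E) ∞ M] [T2Space M]
  (hX : ContMDiff 𝓘(ℝ, E) 𝓘(ℝ, E).tangent ∞ (T% X))
  (hY : ContMDiff 𝓘(ℝ, E) 𝓘(ℝ, E).tangent ∞ (T% Y))
include hX hY

theorem contMDiffVAdd_of_isFlow [AddAction (ℝ × ℝ) M]
    (hfst : IsFlow X fun t p => ((t, 0) : ℝ × ℝ) +ᵥ p)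
    (hsnd : IsFlow Y fun t p => ((0, t) : ℝ × ℝ) +ᵥ p) :
    ContMDiffVAdd 𝓘(ℝ, ℝ × ℝ) 𝓘(ℝ, E) ∞ (ℝ × ℝ) M := by
  refine ⟨?_⟩
  have hfstCoord : ContMDiff (𝓘(ℝ, ℝ × ℝ).prod 𝓘(ℝ, E)) 𝓘(ℝ, ℝ) ∞ fun z : (ℝ × ℝ) × M => z.1.1 :=
    contDiff_fst.contMDiff.comp contMDiff_fst
  have hsndCoord : ContMDiff (𝓘(ℝ, ℝ × ℝ).prod 𝓘(ℝ, E)) 𝓘(ℝ, ℝ) ∞ fun z : (ℝ × ℝ) × M => z.1.2 :=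
    contDiff_snd.contMDiff.comp contMDiff_fst
  exact ((hfst.contMDiff hX).comp
    (hfstCoord.prodMk ((hsnd.contMDiff hY).comp (hsndCoord.prodMk contMDiff_snd)))).congr
      fun z => vadd_eq_fst_vadd_snd_vadd z.1 z.2

theorem exists_addAction_of_isFlow {φ ψ : ℝ → M → M} (hφ : IsFlow X φ) (hψ : IsFlow Y ψ)
    (hXY : ∀ p, VectorField.mlieBracket 𝓘(ℝ, E) X Y p = 0) :
    ∃ _ : AddAction (ℝ × ℝ) M, IsFlow X (fun t p => ((t, 0) : ℝ × ℝ) +ᵥ p) ∧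
      IsFlow Y (fun t p => ((0, t) : ℝ × ℝ) +ᵥ p) := by
  let A : AddAction (ℝ × ℝ) M :=
    { vadd v p := φ v.1 (ψ v.2 p)
      zero_vadd p := (hφ.zero_apply _).trans (hψ.zero_apply p)
      add_vadd v w p := by
        change φ (v.1 + w.1) (ψ (v.2 + w.2) p) = φ v.1 (ψ v.2 (φ w.1 (ψ w.2 p)))
        rw [hφ.add_apply hX, hψ.add_apply hY, hφ.commute hX hψ hY hXY w.1] }
  have hfst (t : ℝ) (p : M) : ((t, 0) : ℝ × ℝ) +ᵥ p = φ t p := congrArg (φ t) (hψ.zero_apply p)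
  have hsnd (t : ℝ) (p : M) : ((0, t) : ℝ × ℝ) +ᵥ p = ψ t p := hφ.zero_apply (ψ t p)
  refine ⟨A, ?_, ?_⟩
  · simpa only [hfst] using hφ
  · simpa only [hsnd] using hψ

end FlowAction

section LinearSystem

variable {E E' F H M : Type*} [NormedAddCommGroup E] [NormedSpace ℝ E]
  [NormedAddCommGroup E'] [NormedSpace ℝ E'] [NormedAddCommGroup F] [NormedSpace ℝ F]
  [TopologicalSpace H] {I : ModelWithCorners ℝ E' H} [TopologicalSpace M] [ChartedSpace H M]

theorem contMDiffAt_of_clm_apply_eq_const [CompleteSpace E] {A : M → E →L[ℝ] F} {v : M → E}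
    {c : F} {x₀ : M} (hA : ContMDiffAt I 𝓘(ℝ, E →L[ℝ] F) ∞ A x₀) (L : E ≃L[ℝ] F) (hL : A x₀ = L)
    (hv : ∀ᶠ x in 𝓝 x₀, A x (v x) = c) : ContMDiffAt I 𝓘(ℝ, E) ∞ v x₀ := by
  have hinverse : ContMDiffAt I 𝓘(ℝ, F →L[ℝ] E) ∞ (fun x => (A x).inverse) x₀ :=
    ContDiffAt.contMDiffAt (hL ▸ contDiffAt_map_inverse L) |>.comp x₀ hA
  have hequiv : ∀ᶠ x in 𝓝 x₀, A x ∈ range ((↑) : (E ≃L[ℝ] F) → (E →L[ℝ] F)) :=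
    hA.continuousAt.eventually (hL ▸ L.nhds)
  refine (hinverse.clm_apply (contMDiffAt_const (c := c))).congr_of_eventuallyEq ?_
  filter_upwards [hv, hequiv] with x hx ⟨N, hN⟩
  rw [← hx, ← hN, ContinuousLinearMap.inverse_equiv]
  exact (N.symm_apply_apply (v x)).symm

theorem contMDiffAt_of_forall_clm_apply_eq [FiniteDimensional ℝ E] {ι : Type*} [Fintype ι]
    (hι : Module.finrank ℝ E = Fintype.card ι) {f : ι → M → E →L[ℝ] ℝ} {v : M → E} {c : ι → ℝ}
    {x₀ : M} (hf : ∀ i, ContMDiffAt I 𝓘(ℝ, E →L[ℝ] ℝ) ∞ (f i) x₀)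
    (hinj : ∀ w, (∀ i, f i x₀ w = 0) → w = 0)
    (hv : ∀ᶠ x in 𝓝 x₀, ∀ i, f i x (v x) = c i) : ContMDiffAt I 𝓘(ℝ, E) ∞ v x₀ := by
  classical
  have hA : ContMDiffAt I 𝓘(ℝ, E →L[ℝ] (ι → ℝ)) ∞
      (fun x => ContinuousLinearMap.pi fun i => f i x) x₀ := by
    have hsum : ∀ x, ContinuousLinearMap.pi (fun i => f i x) = ∑ i,
        (ContinuousLinearMap.smulRightL ℝ E (ι → ℝ)).flip (Pi.single i 1) (f i x) := by
      intro x
      ext w i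
      simp [Finset.sum_apply, Pi.single_apply]
    simp_rw [hsum]
    exact ContMDiffAt.sum fun i _ => (ContinuousLinearMap.contMDiff
      ((ContinuousLinearMap.smulRightL ℝ E (ι → ℝ)).flip (Pi.single i 1))).contMDiffAt.comp x₀
        (hf i)
  have hinjective : Function.Injective
      ((ContinuousLinearMap.pi fun i => f i x₀ : E →L[ℝ] (ι → ℝ)) : E →ₗ[ℝ] (ι → ℝ)) := by
    rw [← LinearMap.ker_eq_bot, LinearMap.ker_eq_bot']
    exact fun w hw => hinj w fun i => congrFun hw i
  exact contMDiffAt_of_clm_apply_eq_const hA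
    (LinearEquiv.ofInjectiveOfFinrankEq _ hinjective (by simp [hι])).toContinuousLinearEquiv rfl
    (hv.mono fun x hx => funext hx)

end LinearSystem

section DualFrame

variable {S : Type*} [TopologicalSpace S] [ChartedSpace E3 S] [IsManifold (𝓡 3) ∞ S]
  (P : CauchyPair S)

namespace CauchyPair

theorem eq_zero_of_forall_e_eq_zero {x : S} {v : TangentSpace (𝓡 3) x}
    (h : ∀ i, P.e i x v = 0) : v = 0 :=
  (P.coord_bijective x).1 ((funext h : P.coord x v = 0).trans (map_zero _).symm)

theorem eq_sum_sharp (x : S) (v : TangentSpace (𝓡 3) x) :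
    v = ∑ i, P.e i x v • P.sharp i x := by
  rw [← sub_eq_zero]
  refine P.eq_zero_of_forall_e_eq_zero fun j => ?_
  simp [map_sub, map_sum, e_sharp]

theorem isSmoothVField_sharp (j : Fin 3) : IsSmoothVField (P.sharp j) := by
  intro x₀
  rw [Bundle.contMDiffAt_section]
  let t := trivializationAt E3 (TangentSpace (𝓡 3) : S → Type _) x₀
  have hx₀ : x₀ ∈ t.baseSet := FiberBundle.mem_baseSet_trivializationAt' x₀
  refine contMDiffAt_of_forall_clm_apply_eq (by simp)
    (f := fun i x => (P.e i x).comp (t.symmL ℝ x)) (c := Pi.single j 1) (fun i => ?_)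
    (fun w hw => ?_) ?_
  · have hcoord := (contMDiffAt_hom_bundle (F₁ := E3) (E₁ := (TangentSpace (𝓡 3) : S → Type _))
      (F₂ := ℝ) (E₂ := Bundle.Trivial S ℝ) _).1 (P.e_smooth i x₀)
    refine hcoord.2.congr_of_eventuallyEq ?_
    filter_upwards [t.open_baseSet.mem_nhds hx₀] with x _
    ext v
    simp [ContinuousLinearMap.inCoordinates, t]
  · have hzero : t.symmL ℝ x₀ w = 0 := P.eq_zero_of_forall_e_eq_zero hw
    rw [← t.continuousLinearMapAt_symmL (R := ℝ) hx₀ w, hzero, map_zero]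
  · filter_upwards [t.open_baseSet.mem_nhds hx₀] with x hx i
    rw [← t.continuousLinearMapAt_apply_of_mem (R := ℝ) hx, ContinuousLinearMap.comp_apply,
      t.symmL_continuousLinearMapAt hx, e_sharp, Pi.single_apply]

variable {P}

theorem e_mlieBracket_sharp {k : Fin 3} (hext : ExtDEqWedge (P.e k) (P.thE k) (P.e 0))
    (i j : Fin 3) (x : S) :
    P.e k x (VectorField.mlieBracket (𝓡 3) (P.sharp i) (P.sharp j) x)
      = P.thE k x (P.sharp j x) * P.e 0 x (P.sharp i x)
        - P.thE k x (P.sharp i x) * P.e 0 x (P.sharp j x) := by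
  have heq := hext _ _ (P.isSmoothVField_sharp i) (P.isSmoothVField_sharp j) x
  simp only [extD, wedge, e_sharp, mvfderiv_const, zero_apply] at heq ⊢
  linarith

theorem mlieBracket_sharp_eq_zero (hext : ∀ k, ExtDEqWedge (P.e k) (P.thE k) (P.e 0)) (x : S) :
    VectorField.mlieBracket (𝓡 3) (P.sharp 1) (P.sharp 2) x = 0 :=
  P.eq_zero_of_forall_e_eq_zero fun k => by simp [e_mlieBracket_sharp (hext k), e_sharp]

end CauchyPair

end DualFrame

section Completeness

variable {E : Type*} [NormedAddCommGroup E] [NormedSpace ℝ E]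
  {M : Type*} [TopologicalSpace M] [ChartedSpace E M] [IsManifold 𝓘(ℝ, E) ∞ M]
  {X : (x : M) → TangentSpace 𝓘(ℝ, E) x} (hX : ContMDiff 𝓘(ℝ, E) 𝓘(ℝ, E).tangent ∞ (T% X))
include hX

theorem contMDiffAt_of_isMIntegralCurveAt [FiniteDimensional ℝ E] {γ : ℝ → M} {t : ℝ}
    (hγ : IsMIntegralCurveAt γ X t) : ContMDiffAt 𝓘(ℝ, ℝ) 𝓘(ℝ, E) ∞ γ t := by
  have : IsManifold 𝓘(ℝ, E) 1 M := .of_le (n := ∞) (by simp)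
  obtain ⟨F, hF⟩ := exists_isChartFlow hX (γ t)
  obtain ⟨ε, hε, hcurve⟩ := hF.exists_isMIntegralCurveOn
  obtain ⟨hzero, hη⟩ := hcurve.self_of_nhds
  set y := extChartAt 𝓘(ℝ, E) (γ t) (γ t)
  set η : ℝ → M := fun s => (extChartAt 𝓘(ℝ, E) (γ t)).symm (F (s, y))
  have hηsmooth : ContMDiffAt 𝓘(ℝ, ℝ) 𝓘(ℝ, E) ∞ η 0 := by
    have hline : ContDiffAt ℝ ∞ (fun s => F (s, y)) 0 :=
      hF.self_of_nhds.1.comp (0 : ℝ) (by fun_prop)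
    refine (contMDiffAt_extChartAt_symm ?_).comp (0 : ℝ) hline.contMDiffAt
    rw [hF.self_of_nhds.2.1]
    exact mem_extChartAt_target (γ t)
  have hshift : IsMIntegralCurveAt (η ∘ (· - t)) X (0 + t) := isMIntegralCurveAt_comp_sub.2
    (hη.isMIntegralCurveAt (Ioo_mem_nhds (neg_lt_zero.2 hε) hε))
  rw [zero_add] at hshift
  have heq : γ =ᶠ[𝓝 t] η ∘ (· - t) :=
    isMIntegralCurveAt_eventuallyEq_of_contMDiffAt_boundaryless ((hX _).of_le (by simp)) hγ hshift
      (by simp only [Function.comp_apply, sub_self, η, hzero])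
  have hsub : ContMDiffAt 𝓘(ℝ, ℝ) 𝓘(ℝ, ℝ) ∞ (· - t) t :=
    (contDiffAt_id.sub contDiffAt_const).contMDiffAt
  rw [← sub_self t] at hηsmooth
  exact ContMDiffAt.congr_of_eventuallyEq (hηsmooth.comp (f := (· - t)) t hsub) heq

variable [T2Space M]

theorem exists_isMIntegralCurveOn_Ioo_of_forall_lt {x : M} {r : ℝ}
    (h : ∀ T < r, ∃ γ : ℝ → M, γ 0 = x ∧ IsMIntegralCurveOn γ X (Ioo (-T) T)) :
    ∃ γ : ℝ → M, γ 0 = x ∧ IsMIntegralCurveOn γ X (Ioo (-r) r) := by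
  have : IsManifold 𝓘(ℝ, E) 1 M := .of_le (n := ∞) (by simp)
  have : Nonempty M := ⟨x⟩
  rcases le_or_gt r 0 with hr | hr
  · exact ⟨fun _ => x, rfl, by simp [Ioo_eq_empty (by linarith : ¬ -r < r), IsMIntegralCurveOn]⟩
  choose! γ hγzero hγ using h
  have heqOn : ∀ T T', T < T' → T' < r → EqOn (γ T) (γ T') (Ioo (-T) T) := by
    intro T T' hT hT' t ht
    exact isMIntegralCurveOn_Ioo_eqOn_of_contMDiff_boundaryless (t₀ := 0)
      (by constructor <;> linarith [ht.1, ht.2]) (hX.of_le (by simp)) (hγ T (hT.trans hT'))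
      ((hγ T' hT').mono (Ioo_subset_Ioo (by linarith) hT.le))
      ((hγzero T (hT.trans hT')).trans (hγzero T' hT').symm) ht
  refine ⟨fun t => γ ((|t| + r) / 2) t, by simpa using hγzero (r / 2) (by linarith),
    fun t ht => ?_⟩
  obtain ⟨T, htT, hTr⟩ : ∃ T, (|t| + r) / 2 < T ∧ T < r :=
    exists_between (by linarith [abs_lt.2 ht])
  have hlt : |t| < (|t| + r) / 2 := by linarith [abs_lt.2 ht]
  have heq : (fun s => γ ((|s| + r) / 2) s) =ᶠ[𝓝 t] γ T := by
    have hnear : ∀ᶠ s in 𝓝 t, (|s| + r) / 2 < T :=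
      ContinuousAt.eventually_lt (by fun_prop) continuousAt_const htT
    filter_upwards [hnear] with s hs
    exact heqOn _ _ hs hTr (abs_lt.1 (by linarith))
  have hderiv := ((hγ T hTr).isMIntegralCurveAt (Ioo_mem_nhds (abs_lt.1 (hlt.trans htT)).1
    (abs_lt.1 (hlt.trans htT)).2)).hasMFDerivAt.congr_of_eventuallyEq heq
  rw [← heq.self_of_nhds] at hderiv
  exact hderiv.hasMFDerivWithinAt

variable [FiniteDimensional ℝ E]

theorem exists_isMIntegralCurveOn_union_Ioo_of_tendsto {γ : ℝ → M} {l r c : ℝ} {t : ℕ → ℝ} {p : M}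
    (hγ : IsMIntegralCurveOn γ X (Ioo l r)) (ht : ∀ n, t n ∈ Ioo l r) (htc : Tendsto t atTop (𝓝 c))
    (hp : Tendsto (fun n => γ (t n)) atTop (𝓝 p)) :
    ∃ ε > 0, ∃ γ' : ℝ → M, EqOn γ' γ (Ioo l r) ∧
      IsMIntegralCurveOn γ' X (Ioo l r ∪ Ioo (c - ε) (c + ε)) := by
  have : IsManifold 𝓘(ℝ, E) 1 M := .of_le (n := ∞) (by simp)
  obtain ⟨F, hF⟩ := exists_isChartFlow hX p
  obtain ⟨ε, hε, hcurve⟩ := hF.exists_isMIntegralCurveOn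
  obtain ⟨n, ⟨hzero, hη⟩, htn⟩ := ((hp.eventually hcurve).and
    (htc.eventually (Metric.ball_mem_nhds c (half_pos hε)))).exists
  rw [Real.dist_eq, abs_lt] at htn
  have hη' := (hη.comp_add (-t n)).mono (s' := Ioo (t n - ε) (t n + ε)) fun s hs => by
    constructor <;> linarith [hs.1, hs.2]
  classical
  refine ⟨ε / 2, half_pos hε, _, piecewise_eqOn _ _ _,
    (isMIntegralCurveOn_piecewise (hX.of_le (by simp)) hγ hη' (t₀ := t n)
      ⟨ht n, by constructor <;> linarith⟩ (by
        rw [Function.comp_apply, add_neg_cancel, hzero])).mono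
        (union_subset_union_right _ (Ioo_subset_Ioo ?_ ?_))⟩ <;> linarith [htn.1, htn.2]

section LimitPoints

variable (hlim : ∀ (γ : ℝ → M) (l r : ℝ), IsMIntegralCurveOn γ X (Ioo l r) → ∀ (t : ℕ → ℝ) (c : ℝ),
  (∀ n, t n ∈ Ioo l r) → Tendsto t atTop (𝓝 c) → ∃ p, Tendsto (fun n => γ (t n)) atTop (𝓝 p))
include hlim

theorem exists_isMIntegralCurveOn_union_Ioo {γ : ℝ → M} {l r c : ℝ}
    (hγ : IsMIntegralCurveOn γ X (Ioo l r)) (hc : c ∈ closure (Ioo l r)) :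
    ∃ ε > 0, ∃ γ' : ℝ → M, EqOn γ' γ (Ioo l r) ∧
      IsMIntegralCurveOn γ' X (Ioo l r ∪ Ioo (c - ε) (c + ε)) := by
  obtain ⟨t, ht, htc⟩ := mem_closure_iff_seq_limit.1 hc
  obtain ⟨p, hp⟩ := hlim γ l r hγ t c ht htc
  exact exists_isMIntegralCurveOn_union_Ioo_of_tendsto hX hγ ht htc hp

theorem exists_isMIntegralCurveOn_Ioo_gt {γ : ℝ → M} {r : ℝ} (hr : 0 < r)
    (hγ : IsMIntegralCurveOn γ X (Ioo (-r) r)) :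
    ∃ R > r, ∃ γ' : ℝ → M, γ' 0 = γ 0 ∧ IsMIntegralCurveOn γ' X (Ioo (-R) R) := by
  have hright : r ∈ closure (Ioo (-r) r) := by
    rw [closure_Ioo (by linarith)]
    exact right_mem_Icc.2 (by linarith)
  obtain ⟨ε, hε, γ₁, heq₁, hγ₁⟩ := exists_isMIntegralCurveOn_union_Ioo hX hlim hγ hright
  have hleft : -r ∈ closure (Ioo (-r) (r + ε)) := by
    rw [closure_Ioo (by linarith)]
    exact left_mem_Icc.2 (by linarith)
  obtain ⟨δ, hδ, γ₂, heq₂, hγ₂⟩ := exists_isMIntegralCurveOn_union_Ioo hX hlim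
    (hγ₁.mono fun t ht => by grind) hleft
  refine ⟨r + min ε δ, by simp [hε, hδ], γ₂, ?_, hγ₂.mono fun t ht => by grind⟩
  rw [heq₂ (by constructor <;> linarith), heq₁ (by constructor <;> linarith)]

theorem exists_isMIntegralCurve_of_forall_tendsto (x : M) :
    ∃ γ : ℝ → M, γ 0 = x ∧ IsMIntegralCurve γ X := by
  have : IsManifold 𝓘(ℝ, E) 1 M := .of_le (n := ∞) (by simp)
  set A : Set ℝ := {T | ∃ γ : ℝ → M, γ 0 = x ∧ IsMIntegralCurveOn γ X (Ioo (-T) T)}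
  have hdown : ∀ T ∈ A, ∀ T' ≤ T, T' ∈ A := fun T ⟨γ, hzero, hγ⟩ T' hT' =>
    ⟨γ, hzero, hγ.mono (Ioo_subset_Ioo (by linarith) hT')⟩
  suffices hunbounded : ¬ BddAbove A by
    rw [exists_isMIntegralCurve_iff_exists_isMIntegralCurveOn_Ioo (hX.of_le (by simp))]
    intro T
    obtain ⟨T', hT', hlt⟩ := not_bddAbove_iff.1 hunbounded T
    exact hdown T' hT' T hlt.le
  intro hbdd
  obtain ⟨_, hF⟩ := exists_isChartFlow hX x
  obtain ⟨ε, hε, hcurve⟩ := hF.exists_isMIntegralCurveOn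
  have hεA : ε ∈ A := ⟨_, hcurve.self_of_nhds.1, hcurve.self_of_nhds.2⟩
  have hsSup : sSup A ∈ A := exists_isMIntegralCurveOn_Ioo_of_forall_lt hX fun T hT => by
    obtain ⟨T', hT', hlt⟩ := exists_lt_of_lt_csSup ⟨ε, hεA⟩ hT
    exact hdown T' hT' T hlt.le
  obtain ⟨γ, hγzero, hγ⟩ := hsSup
  obtain ⟨R, hR, γ', hzero, hγ'⟩ :=
    exists_isMIntegralCurveOn_Ioo_gt hX hlim (hε.trans_le (le_csSup hbdd hεA)) hγ
  exact hR.not_ge (le_csSup hbdd ⟨γ', hzero.trans hγzero, hγ'⟩)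

end LimitPoints

end Completeness

section CompleteMetric

variable {S : Type*} [TopologicalSpace S] [ChartedSpace E3 S] [IsManifold (𝓡 3) ∞ S]

theorem IsGeneratedBy.eq [T2Space S] {A B : AddAction (ℝ × ℝ) S} {X Y : VField S}
    (hX : IsSmoothVField X) (hY : IsSmoothVField Y) (hA : IsGeneratedBy A X Y)
    (hB : IsGeneratedBy B X Y) : A = B := by
  have : IsManifold (𝓡 3) 1 S := .of_le (n := ∞) (by simp)
  have hfst (t : ℝ) (p : S) : A.vadd (t, 0) p = B.vadd (t, 0) p :=
    congrFun (isMIntegralCurve_Ioo_eq_of_contMDiff_boundaryless (t₀ := 0) (hX.of_le (by simp))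
      (hA p).1 (hB p).1 ((A.zero_vadd p).trans (B.zero_vadd p).symm)) t
  have hsnd (t : ℝ) (p : S) : A.vadd (0, t) p = B.vadd (0, t) p :=
    congrFun (isMIntegralCurve_Ioo_eq_of_contMDiff_boundaryless (t₀ := 0) (hY.of_le (by simp))
      (hA p).2 (hB p).2 ((A.zero_vadd p).trans (B.zero_vadd p).symm)) t
  refine AddAction.ext (funext fun v => funext fun p => ?_)
  exact (@vadd_eq_fst_vadd_snd_vadd S A v p).trans (((hfst _ _).trans
    (congrArg (B.vadd (v.1, 0)) (hsnd _ _))).trans (@vadd_eq_fst_vadd_snd_vadd S B v p).symm)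

namespace CauchyPair

variable (P : CauchyPair S)

theorem metric_smul (c : ℝ) (x : S) (v : TangentSpace (𝓡 3) x) :
    P.metric x (c • v) (c • v) = c ^ 2 * P.metric x v v := by
  simp only [metric, map_smul, smul_eq_mul, Finset.mul_sum]
  exact Finset.sum_congr rfl fun i _ => by ring

variable {P} {X : VField S} (hX : IsSmoothVField X)
  (hle : ∀ x, P.metric x (X x) (X x) ≤ 1)
include hX hle

theorem rDist_le_of_isMIntegralCurveOn {γ : ℝ → S} {l r s t : ℝ}
    (hγ : IsMIntegralCurveOn (I := 𝓡 3) γ X (Ioo l r)) (hs : s ∈ Ioo l r) (ht : t ∈ Ioo l r) :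
    P.rDist (γ s) (γ t) ≤ ENNReal.ofReal |t - s| := by
  let _ : ∀ x : S, ENorm (TangentSpace (𝓡 3) x) :=
    fun x => ⟨fun v => ENNReal.ofReal (Real.sqrt (P.metric x v v))⟩
  have _ : ∀ x : S, ENormSMulClass ℝ (TangentSpace (𝓡 3) x) := fun x => ⟨fun c v => by
    change ENNReal.ofReal (Real.sqrt (P.metric x (c • v) (c • v))) =
      ‖c‖ₑ * ENNReal.ofReal (Real.sqrt (P.metric x v v))
    rw [P.metric_smul, Real.sqrt_mul (sq_nonneg c), Real.sqrt_sq_eq_abs,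
      ENNReal.ofReal_mul (abs_nonneg c), ← Real.norm_eq_abs, ofReal_norm]⟩
  wlog hst : s ≤ t generalizing s t
  · rw [abs_sub_comm]
    exact Manifold.riemannianEDist_comm.trans_le (this ht hs (le_of_not_ge hst))
  have hγt : ∀ u ∈ Icc s t, IsMIntegralCurveAt (I := 𝓡 3) γ X u := fun u hu =>
    hγ.isMIntegralCurveAt (Ioo_mem_nhds (hs.1.trans_le hu.1) (hu.2.trans_lt ht.2))
  have hspeed : ∀ u ∈ Icc s t, ‖mfderiv 𝓘(ℝ, ℝ) (𝓡 3) γ u 1‖ₑ ≤ 1 := by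
    intro u hu
    rw [(hγt u hu).hasMFDerivAt.mfderiv]
    change ENNReal.ofReal (Real.sqrt (P.metric (γ u) ((1 : ℝ) • X (γ u)) ((1 : ℝ) • X (γ u)))) ≤ 1
    rw [one_smul]
    exact ENNReal.ofReal_le_one.2 (Real.sqrt_le_one.2 (hle _))
  calc P.rDist (γ s) (γ t) ≤ Manifold.pathELength (𝓡 3) γ s t :=
        Manifold.riemannianEDist_le_pathELength (fun u hu => ((contMDiffAt_of_isMIntegralCurveAt hX
          (hγt u hu)).of_le (by simp)).contMDiffWithinAt) rfl rfl hst
    _ = ∫⁻ u in Icc s t, ‖mfderiv 𝓘(ℝ, ℝ) (𝓡 3) γ u 1‖ₑ :=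
        Manifold.pathELength_eq_lintegral_mfderiv_Icc
    _ ≤ ∫⁻ _ in Icc s t, 1 := MeasureTheory.setLIntegral_mono' measurableSet_Icc hspeed
    _ = ENNReal.ofReal |t - s| := by simp [abs_of_nonneg (sub_nonneg.2 hst)]

theorem IsComplete.exists_tendsto (hcomp : P.IsComplete) {γ : ℝ → S} {l r c : ℝ} {t : ℕ → ℝ}
    (hγ : IsMIntegralCurveOn (I := 𝓡 3) γ X (Ioo l r)) (ht : ∀ n, t n ∈ Ioo l r)
    (htc : Tendsto t atTop (𝓝 c)) : ∃ p, Tendsto (fun n => γ (t n)) atTop (𝓝 p) := by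
  refine hcomp _ fun ε hε => ?_
  obtain ⟨N, hN⟩ := EMetric.cauchySeq_iff.1 htc.cauchySeq ε hε
  refine ⟨N, fun m hm n hn =>
    (rDist_le_of_isMIntegralCurveOn hX hle hγ (ht m) (ht n)).trans_lt ?_⟩
  rw [← Real.dist_eq, ← edist_dist]
  exact hN n hn m hm

theorem IsComplete.isCompleteVField [T2Space S] (hcomp : P.IsComplete) : IsCompleteVField X :=
  exists_isMIntegralCurve_of_forall_tendsto hX fun _ _ _ hγ _ _ ht htc =>
    hcomp.exists_tendsto hX hle hγ ht htc

omit hX hle in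
theorem IsComplete.isCompleteVField_sharp [T2Space S] (hcomp : P.IsComplete) (i : Fin 3) :
    IsCompleteVField (P.sharp i) :=
  hcomp.isCompleteVField (P.isSmoothVField_sharp i) fun x => by simp [metric_sharp, e_sharp]

end CauchyPair

end CompleteMetric

section TranslationQuotient

theorem contMDiffAt_of_comp_isLocalDiffeomorphAt {𝕜 E E' E'' H H' H'' M M' M'' : Type*}
    [NontriviallyNormedField 𝕜] [NormedAddCommGroup E] [NormedSpace 𝕜 E] [NormedAddCommGroup E']
    [NormedSpace 𝕜 E'] [NormedAddCommGroup E''] [NormedSpace 𝕜 E''] [TopologicalSpace H]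
    [TopologicalSpace H'] [TopologicalSpace H''] {I : ModelWithCorners 𝕜 E H}
    {I' : ModelWithCorners 𝕜 E' H'} {I'' : ModelWithCorners 𝕜 E'' H''} [TopologicalSpace M]
    [ChartedSpace H M] [TopologicalSpace M'] [ChartedSpace H' M'] [TopologicalSpace M'']
    [ChartedSpace H'' M''] {n : WithTop ℕ∞} {q : M → M'} {f : M' → M''} {x : M}
    (hq : IsLocalDiffeomorphAt I I' n q x) (hf : ContMDiffAt I I'' n (f ∘ q) x) :
    ContMDiffAt I' I'' n f (q x) := by
  have hinv : hq.localInverse (q x) = x := hq.localInverse_left_inv hq.localInverse_mem_target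
  have hcomp : ContMDiffAt I' I'' n ((f ∘ q) ∘ hq.localInverse) (q x) :=
    ContMDiffAt.comp (q x) (hinv.symm ▸ hf) hq.localInverse_contMDiffAt
  exact hcomp.congr_of_eventuallyEq
    (hq.localInverse_eventuallyEq_right.mono fun y hy => (congrArg f hy).symm)

theorem tendsto_add_sub_nhds {E : Type*} [AddCommGroup E] [TopologicalSpace E]
    [IsTopologicalAddGroup E] (v w : E) : Tendsto (fun u => w + (u - v)) (𝓝 v) (𝓝 w) := by
  have hcont : Continuous fun u => w + (u - v) := by fun_prop
  simpa only [sub_self, add_zero] using hcont.tendsto v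

/-- An open quotient map `q : E → N` on a normed group which is injective near `0` and whose
equivalence relation is invariant under translations; it makes `N` a manifold modelled on `E`. -/
structure IsTranslationQuotient {E N : Type*} [NormedAddCommGroup E] [TopologicalSpace N]
    (q : E → N) : Prop where
  isOpenQuotientMap : IsOpenQuotientMap q
  add_right : ∀ v w u, q v = q w → q (v + u) = q (w + u)
  exists_injOn : ∃ δ > 0, InjOn q (Metric.ball 0 δ)

namespace IsTranslationQuotient

variable {E N : Type*} [NormedAddCommGroup E] [TopologicalSpace N] {q : E → N}
  (hq : IsTranslationQuotient q)
include hq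

theorem comp {𝕜 F : Type*} [NontriviallyNormedField 𝕜] [NormedSpace 𝕜 E] [NormedAddCommGroup F]
    [NormedSpace 𝕜 F] (e : F ≃L[𝕜] E) : IsTranslationQuotient (q ∘ e) := by
  refine ⟨hq.isOpenQuotientMap.comp e.toHomeomorph.isOpenQuotientMap, fun v w u h => ?_, ?_⟩
  · simpa only [Function.comp_apply, map_add] using hq.add_right _ _ (e u) h
  · obtain ⟨δ, hδ, hinj⟩ := hq.exists_injOn
    have hball : e ⁻¹' Metric.ball 0 δ ∈ 𝓝 0 :=
      e.continuous.continuousAt.preimage_mem_nhds (by simpa using Metric.ball_mem_nhds _ hδ)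
    obtain ⟨ε, hε, hsub⟩ := Metric.mem_nhds_iff.1 hball
    exact ⟨ε, hε, (hinj.comp e.injective.injOn (mapsTo_preimage _ _)).mono hsub⟩

/-- The radius of balls on which the quotient map is injective. -/
def radius : ℝ := hq.exists_injOn.choose

theorem radius_pos : 0 < hq.radius := hq.exists_injOn.choose_spec.1

theorem injOn_ball (v : E) : InjOn q (Metric.ball v hq.radius) := by
  intro w hw w' hw' h
  rw [mem_ball_iff_norm] at hw hw'
  have hsub := hq.add_right w w' (-v) h
  rw [← sub_eq_add_neg, ← sub_eq_add_neg] at hsub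
  exact sub_left_injective (hq.exists_injOn.choose_spec.2 (mem_ball_zero_iff.2 hw)
    (mem_ball_zero_iff.2 hw') hsub)

/-- A chosen preimage of a point of the quotient. -/
def lift (x : N) : E := Function.surjInv hq.isOpenQuotientMap.surjective x

theorem apply_lift (x : N) : q (hq.lift x) = x := Function.surjInv_eq _ x

/-- The quotient map restricted to the ball around the chosen preimage of `x`: a local
parametrization of the quotient near `x`. -/
def param (x : N) : OpenPartialHomeomorph E N :=
  OpenPartialHomeomorph.ofContinuousOpen (hq.injOn_ball (hq.lift x)).toPartialEquiv
    hq.isOpenQuotientMap.continuous.continuousOn hq.isOpenQuotientMap.isOpenMap Metric.isOpen_ball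

theorem coe_param (x : N) : ⇑(hq.param x) = q := rfl

theorem lift_mem_param_source (x : N) : hq.lift x ∈ (hq.param x).source :=
  Metric.mem_ball_self hq.radius_pos

theorem mem_param_target (x : N) : x ∈ (hq.param x).target := by
  simpa only [coe_param, apply_lift] using (hq.param x).map_source (hq.lift_mem_param_source x)

/-- The manifold structure of the quotient, whose charts are the inverses of the local
parametrizations. -/
abbrev chartedSpace : ChartedSpace E N where
  atlas := range fun x => (hq.param x).symm
  chartAt x := (hq.param x).symm
  mem_chart_source x := hq.mem_param_target x
  chart_mem_atlas x := mem_range_self x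

theorem eventually_param_symm_eq {x : N} {v w : E} (hw : w ∈ (hq.param x).source)
    (h : q w = q v) : ∀ᶠ u in 𝓝 v, (hq.param x).symm (q u) = w + (u - v) := by
  filter_upwards [(tendsto_add_sub_nhds v w).eventually ((hq.param x).open_source.mem_nhds hw)]
    with u hu
  have hqu := hq.add_right w v (u - v) h
  rw [add_sub_cancel] at hqu
  rw [← hqu]
  exact (hq.param x).left_inv hu

variable [NormedSpace ℝ E]

theorem isManifold :
    letI := hq.chartedSpace
    IsManifold 𝓘(ℝ, E) ∞ N := by
  let := hq.chartedSpace
  refine isManifold_of_contDiffOn _ _ _ ?_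
  rintro _ _ ⟨x, rfl⟩ ⟨y, rfl⟩ v hv
  simp only [modelWithCornersSelf_coe, modelWithCornersSelf_coe_symm, range_id, inter_univ,
    preimage_id_eq, id_eq, OpenPartialHomeomorph.trans_source, OpenPartialHomeomorph.symm_symm,
    OpenPartialHomeomorph.symm_source, mem_inter_iff, mem_preimage, coe_param] at hv
  have htranslation := hq.eventually_param_symm_eq ((hq.param y).map_target hv.2)
    ((hq.param y).right_inv hv.2)
  have htransition : ContDiffAt ℝ ∞ (fun u => (hq.param y).symm (q u)) v :=
    ContDiffAt.congr_of_eventuallyEq (by fun_prop) htranslation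
  exact htransition.contDiffWithinAt

theorem exists_isLocalDiffeomorphAt (x : N) :
    letI := hq.chartedSpace
    ∃ v, q v = x ∧ IsLocalDiffeomorphAt 𝓘(ℝ, E) 𝓘(ℝ, E) ∞ q v := by
  let := hq.chartedSpace
  have := hq.isManifold
  refine ⟨hq.lift x, hq.apply_lift x, ?_⟩
  let Φ : PartialDiffeomorph 𝓘(ℝ, E) 𝓘(ℝ, E) E N ∞ :=
    { (hq.param x).toPartialEquiv with
      open_source := (hq.param x).open_source
      open_target := (hq.param x).open_target
      contMDiffOn_toFun := contMDiffOn_chart_symm (x := x)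
      contMDiffOn_invFun := contMDiffOn_chart (x := x) }
  exact ⟨Φ, hq.lift_mem_param_source x, fun _ _ => rfl⟩

theorem contMDiff {E' H' M : Type*} [NormedAddCommGroup E'] [NormedSpace ℝ E']
    [TopologicalSpace H'] {I : ModelWithCorners ℝ E' H'} [TopologicalSpace M] [ChartedSpace H' M]
    {f : N → M} (hf : ContMDiff 𝓘(ℝ, E) I ∞ (f ∘ q)) :
    letI := hq.chartedSpace
    ContMDiff 𝓘(ℝ, E) I ∞ f := by
  let := hq.chartedSpace
  intro x
  obtain ⟨v, rfl, hv⟩ := hq.exists_isLocalDiffeomorphAt x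
  exact contMDiffAt_of_comp_isLocalDiffeomorphAt hv (hf v)

end IsTranslationQuotient

end TranslationQuotient

section OrbitSpace

variable {V : Type*} [NormedAddCommGroup V] {M : Type*} [AddAction V M]

variable (V) in
/-- The orbit of a point, as a type separate from the subtype of `M` because it carries the
quotient topology of the group instead of the subspace topology. -/
def OrbitSpace (p : M) : Type _ := AddAction.orbit V p

namespace OrbitSpace

/-- The inclusion of an orbit. -/
def incl (p : M) : OrbitSpace V p → M := Subtype.val

theorem incl_injective (p : M) : Function.Injective (incl (V := V) p) := Subtype.val_injective

theorem range_incl (p : M) : range (incl (V := V) p) = AddAction.orbit V p := Subtype.range_val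

/-- The map from the group to the orbit of `p`. -/
def orbitMap (p : M) (v : V) : OrbitSpace V p := ⟨v +ᵥ p, mem_range_self _⟩

instance (p : M) : TopologicalSpace (OrbitSpace V p) :=
  TopologicalSpace.coinduced (orbitMap p) inferInstance

theorem orbitMap_eq_iff {p : M} {v w : V} : orbitMap p v = orbitMap p w ↔ v +ᵥ p = w +ᵥ p :=
  Subtype.ext_iff

theorem orbitMap_add_right (p : M) (v w u : V) (h : orbitMap p v = orbitMap p w) :
    orbitMap p (v + u) = orbitMap p (w + u) := by
  rw [orbitMap_eq_iff] at h ⊢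
  rw [add_comm v, add_comm w, add_vadd, add_vadd, h]

theorem isOpenQuotientMap_orbitMap (p : M) : IsOpenQuotientMap (orbitMap (V := V) p) := by
  refine ⟨fun ⟨_, v, hv⟩ => ⟨v, Subtype.ext hv⟩, continuous_coinduced_rng, fun U hU => ?_⟩
  refine isOpen_coinduced.2 (isOpen_iff_mem_nhds.2 ?_)
  rintro v ⟨w, hw, h⟩
  filter_upwards [(tendsto_add_sub_nhds v w).eventually (hU.mem_nhds hw)] with u hu
  refine ⟨_, hu, ?_⟩
  rw [orbitMap_add_right p w v (u - v) h, add_sub_cancel]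

variable [NormedSpace ℝ V] {E : Type*} [NormedAddCommGroup E] [NormedSpace ℝ E]
  [TopologicalSpace M] [ChartedSpace E M] [ContMDiffVAdd 𝓘(ℝ, V) 𝓘(ℝ, E) ∞ V M]

theorem isTranslationQuotient_orbitMap [FiniteDimensional ℝ V] {p : M}
    (hinj : Function.Injective (infinitesimalVAdd V E p)) :
    IsTranslationQuotient (orbitMap (V := V) p) := by
  obtain ⟨δ, hδ, hball⟩ := exists_injOn_vadd_point hinj
  exact ⟨isOpenQuotientMap_orbitMap p, orbitMap_add_right p,
    δ, hδ, fun v hv w hw hvw => hball hv hw (orbitMap_eq_iff.1 hvw)⟩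

section Chart

variable {F : Type*} [NormedAddCommGroup F] [NormedSpace ℝ F] {e : F ≃L[ℝ] V} {p : M}
  (hq : IsTranslationQuotient (orbitMap p ∘ e))

theorem contMDiff_incl :
    letI := hq.chartedSpace
    ContMDiff 𝓘(ℝ, F) 𝓘(ℝ, E) ∞ (incl (V := V) p) :=
  hq.contMDiff ((contMDiff_vadd_point p).comp e.contDiff.contMDiff)

theorem exists_mfderiv_incl_eq (x : OrbitSpace V p) :
    letI := hq.chartedSpace
    ∃ D : TangentSpace 𝓘(ℝ, F) x ≃L[ℝ] V, ∀ w,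
      mfderiv 𝓘(ℝ, F) 𝓘(ℝ, E) (incl p) x w = infinitesimalVAdd V E (incl p x) (D w) := by
  let := hq.chartedSpace
  obtain ⟨v, rfl, hv⟩ := hq.exists_isLocalDiffeomorphAt x
  let D := hv.mfderivToContinuousLinearEquiv (by simp)
  have hincl := ((contMDiff_incl (E := E) hq).mdifferentiable (by simp) (orbitMap p (e v)))
  have hchain := hasMFDerivAt_unique
    (hincl.hasMFDerivAt.comp v (hv.mdifferentiableAt (by simp)).hasMFDerivAt)
    ((hasMFDerivAt_vadd_point (E := E) (e v) p).comp v e.hasFDerivAt.hasMFDerivAt)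
  refine ⟨D.symm.trans e, fun w => ?_⟩
  have hw := congrArg (fun L : F →L[ℝ] E => L (D.symm w)) hchain
  refine (congrArg _ (D.apply_symm_apply w).symm).trans hw

end Chart

end OrbitSpace

end OrbitSpace

section Leaves

theorem eventually_exists_contMDiff_path {E N : Type*} [NormedAddCommGroup E]
    [InnerProductSpace ℝ E] [TopologicalSpace N] [ChartedSpace E N] [IsManifold 𝓘(ℝ, E) ∞ N]
    (y : N) : ∀ᶠ z in 𝓝 y, ∃ γ : ℝ → N, ContMDiff 𝓘(ℝ, ℝ) 𝓘(ℝ, E) ∞ γ ∧ γ 0 = y ∧ γ 1 = z := by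
  let c := chartAt E y
  have hyc : y ∈ c.source := mem_chart_source E y
  obtain ⟨r, hr, hball⟩ := Metric.isOpen_iff.1 c.open_target (c y) (c.map_source hyc)
  let b := OpenPartialHomeomorph.univBall (c y) r
  have hbmem (u : E) : b u ∈ c.target :=
    hball (OpenPartialHomeomorph.univBall_target (c y) hr ▸ b.map_source (by simp [b]))
  have hnear : ∀ᶠ z in 𝓝 y, c z ∈ Metric.ball (c y) r :=
    (c.continuousAt hyc).eventually (Metric.ball_mem_nhds _ hr)
  filter_upwards [hnear, c.open_source.mem_nhds hyc] with z hz hzc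
  refine ⟨fun t => c.symm (b (t • b.symm (c z))), ?_, ?_, ?_⟩
  · have hline : ContDiff ℝ ∞ fun t : ℝ => b (t • b.symm (c z)) :=
      OpenPartialHomeomorph.contDiff_univBall.comp (by fun_prop)
    exact contMDiffOn_chart_symm.comp_contMDiff hline.contMDiff fun t => hbmem _
  · simp [b, c.left_inv hyc]
  · have hbz : b (b.symm (c z)) = c z :=
      b.right_inv (OpenPartialHomeomorph.univBall_target (c y) hr ▸ hz)
    simp only [one_smul, hbz, c.left_inv hzc]

theorem IsSmoothOneForm.continuous_apply_mfderiv {S : Type*} [TopologicalSpace S]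
    [ChartedSpace E3 S] [IsManifold (𝓡 3) ∞ S] {a : OneForm S} (ha : IsSmoothOneForm a)
    {γ : ℝ → S} (hγ : ContMDiff 𝓘(ℝ, ℝ) (𝓡 3) ∞ γ) :
    Continuous fun t => a (γ t) (mfderiv 𝓘(ℝ, ℝ) (𝓡 3) γ t 1) := by
  have hlift : ContMDiff 𝓘(ℝ, ℝ) 𝓘(ℝ, ℝ).tangent ∞
      fun t : ℝ => (⟨t, (1 : ℝ)⟩ : TangentBundle 𝓘(ℝ, ℝ) ℝ) :=
    contMDiff_vectorSpace_iff_contDiff.2 contDiff_const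
  have hvelocity : ContMDiff 𝓘(ℝ, ℝ) (𝓡 3).tangent ∞ fun t =>
      Bundle.TotalSpace.mk' E3 (γ t) (mfderiv 𝓘(ℝ, ℝ) (𝓡 3) γ t 1) :=
    (hγ.contMDiff_tangentMap (m := ∞) (by simp)).comp hlift
  have happly := ContMDiff.clm_bundle_apply (E₂ := Bundle.Trivial S ℝ) (ha.comp hγ) hvelocity
  exact continuous_iff_continuousAt.2 fun t =>
    (Bundle.contMDiffAt_totalSpace.1 (happly t)).2.continuousAt

end Leaves

section GeneratedAction

variable {S : Type*} [TopologicalSpace S] [ChartedSpace E3 S] {X Y : VField S}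
  [A : AddAction (ℝ × ℝ) S]

theorem IsGeneratedBy.isFlow_fst (hA : IsGeneratedBy A X Y) :
    IsFlow X fun t p => ((t, 0) : ℝ × ℝ) +ᵥ p :=
  ⟨zero_vadd _, fun p => (hA p).1⟩

theorem IsGeneratedBy.isFlow_snd (hA : IsGeneratedBy A X Y) :
    IsFlow Y fun t p => ((0, t) : ℝ × ℝ) +ᵥ p :=
  ⟨zero_vadd _, fun p => (hA p).2⟩

variable [IsManifold (𝓡 3) ∞ S] [T2Space S]

theorem IsGeneratedBy.isSmoothAction (hA : IsGeneratedBy A X Y) (hX : IsSmoothVField X)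
    (hY : IsSmoothVField Y) : IsSmoothAction A :=
  contMDiffVAdd_of_isFlow hX hY hA.isFlow_fst hA.isFlow_snd

namespace CauchyPair

variable {P : CauchyPair S} (hA : IsGeneratedBy A (P.sharp 1) (P.sharp 2))
include hA

theorem isSmoothAction_of_isGeneratedBy : IsSmoothAction A :=
  hA.isSmoothAction (P.isSmoothVField_sharp 1) (P.isSmoothVField_sharp 2)

theorem infinitesimalVAdd_apply (p : S) (w : ℝ × ℝ) :
    infinitesimalVAdd (ℝ × ℝ) E3 p w = w.1 • P.sharp 1 p + w.2 • P.sharp 2 p :=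
  have : ContMDiffVAdd 𝓘(ℝ, ℝ × ℝ) (𝓡 3) ∞ (ℝ × ℝ) S := isSmoothAction_of_isGeneratedBy hA
  infinitesimalVAdd_of_isFlow hA.isFlow_fst hA.isFlow_snd p w

theorem infinitesimalVAdd_injective (p : S) :
    Function.Injective (infinitesimalVAdd (ℝ × ℝ) E3 p) := by
  intro v w h
  rw [infinitesimalVAdd_apply hA, infinitesimalVAdd_apply hA] at h
  have hfst := congrArg (P.e 1 p) h
  have hsnd := congrArg (P.e 2 p) h
  simp only [map_add, map_smul, e_sharp] at hfst hsnd
  exact Prod.ext (by simpa using hfst) (by simpa using hsnd)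

theorem infinitesimalVAdd_eq_of_e_eq_zero {p : S} {v : TangentSpace (𝓡 3) p}
    (hv : P.e 0 p v = 0) : infinitesimalVAdd (ℝ × ℝ) E3 p (P.e 1 p v, P.e 2 p v) = v := by
  rw [infinitesimalVAdd_apply hA]
  refine Eq.trans ?_ (P.eq_sum_sharp p v).symm
  rw [Fin.sum_univ_three, hv, zero_smul, zero_add]

theorem range_infinitesimalVAdd (p : S) :
    range (infinitesimalVAdd (ℝ × ℝ) E3 p) = {v | P.e 0 p v = 0} := by
  refine Subset.antisymm ?_ fun v hv => ⟨_, infinitesimalVAdd_eq_of_e_eq_zero hA hv⟩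
  rintro _ ⟨w, rfl⟩
  rw [mem_ofPred_eq, infinitesimalVAdd_apply hA]
  simp [e_sharp]

theorem mem_orbit_of_e_mfderiv_eq_zero {γ : ℝ → S} (hγ : ContMDiff 𝓘(ℝ, ℝ) (𝓡 3) ∞ γ)
    (hker : ∀ t, P.e 0 (γ t) (mfderiv 𝓘(ℝ, ℝ) (𝓡 3) γ t 1) = 0) (t : ℝ) :
    γ t ∈ AddAction.orbit (ℝ × ℝ) (γ 0) := by
  have : ContMDiffVAdd 𝓘(ℝ, ℝ × ℝ) (𝓡 3) ∞ (ℝ × ℝ) S := isSmoothAction_of_isGeneratedBy hA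
  refine mem_orbit_of_forall_hasMFDerivAt (E := E3)
    (((P.e_smooth 1).continuous_apply_mfderiv hγ).prodMk
      ((P.e_smooth 2).continuous_apply_mfderiv hγ)) (fun s => ?_) t
  rw [infinitesimalVAdd_eq_of_e_eq_zero hA (hker s)]
  refine (hγ.mdifferentiable (by simp) s).hasMFDerivAt.congr_mfderiv ?_
  ext
  exact (one_smul ℝ (_ : E3)).symm

section Surface

variable {N : Type*} [TopologicalSpace N] [ChartedSpace E2 N] [IsManifold (𝓡 2) ∞ N] {f : N → S}
  (hf : ContMDiff (𝓡 2) (𝓡 3) ∞ f)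
  (hker : ∀ y v, P.e 0 (f y) (mfderiv (𝓡 2) (𝓡 3) f y v) = 0)
include hf hker

theorem eventually_mem_orbit (y : N) : ∀ᶠ z in 𝓝 y, f z ∈ AddAction.orbit (ℝ × ℝ) (f y) := by
  filter_upwards [eventually_exists_contMDiff_path (E := E2) y]
  rintro _ ⟨γ, hγ, rfl, rfl⟩
  refine mem_orbit_of_e_mfderiv_eq_zero hA (hf.comp hγ) (fun t => ?_) 1
  rw [mfderiv_comp t (hf.mdifferentiable (by simp) _) (hγ.mdifferentiable (by simp) _)]
  exact hker _ _

theorem range_subset_orbit [PreconnectedSpace N] (y : N) :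
    range f ⊆ AddAction.orbit (ℝ × ℝ) (f y) := by
  rintro _ ⟨z, rfl⟩
  refine forall_of_eventually_iff (P := fun z => f z ∈ AddAction.orbit (ℝ × ℝ) (f y)) (fun x => ?_)
    (AddAction.mem_orbit_self _) z
  filter_upwards [eventually_mem_orbit hA hf hker x] with z hz
  rw [← AddAction.orbit_eq_iff, ← AddAction.orbit_eq_iff, AddAction.orbit_eq_iff.2 hz]

end Surface

end CauchyPair

end GeneratedAction

section Leaves

universe u

variable {S : Type u} [TopologicalSpace S] [ChartedSpace E3 S]

theorem IsIntegralSurface.nonempty {a : OneForm S} {L : Set S} (hL : IsIntegralSurface a L) :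
    L.Nonempty := by
  obtain ⟨N, _, _, f, -, -, -, _, -, -, -, -, rfl⟩ := hL
  exact range_nonempty f

namespace CauchyPair

variable [IsManifold (𝓡 3) ∞ S] [T2Space S] {P : CauchyPair S} [A : AddAction (ℝ × ℝ) S]
  (hA : IsGeneratedBy A (P.sharp 1) (P.sharp 2))
include hA

theorem isIntegralSurface_orbit (p : S) :
    IsIntegralSurface (P.e 0) (AddAction.orbit (ℝ × ℝ) p) := by
  have : ContMDiffVAdd 𝓘(ℝ, ℝ × ℝ) (𝓡 3) ∞ (ℝ × ℝ) S := isSmoothAction_of_isGeneratedBy hA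
  let e : E2 ≃L[ℝ] ℝ × ℝ := .ofFinrankEq (by simp)
  have hq := (OrbitSpace.isTranslationQuotient_orbitMap (infinitesimalVAdd_injective hA p)).comp e
  let := hq.chartedSpace
  have hincl : ContMDiff (𝓡 2) (𝓡 3) ∞ (OrbitSpace.incl p) := OrbitSpace.contMDiff_incl hq
  refine ⟨OrbitSpace (ℝ × ℝ) p, inferInstance, hq.chartedSpace, OrbitSpace.incl p, hq.isManifold,
    .of_injective_continuous (OrbitSpace.incl_injective p) hincl.continuous,
    hq.isOpenQuotientMap.isQuotientMap.secondCountableTopology hq.isOpenQuotientMap.isOpenMap,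
    hq.isOpenQuotientMap.surjective.connectedSpace hq.isOpenQuotientMap.continuous,
    hincl, OrbitSpace.incl_injective p, fun x => ?_, fun x => ?_, OrbitSpace.range_incl p⟩ <;>
  obtain ⟨D, hD⟩ := OrbitSpace.exists_mfderiv_incl_eq (E := E3) hq x
  · exact fun v w h => D.injective (infinitesimalVAdd_injective hA _
      ((hD v).symm.trans (h.trans (hD w))))
  · exact (congrArg range (funext hD)).trans
      ((D.surjective.range_comp _).trans (range_infinitesimalVAdd hA _))

theorem subset_orbit {L : Set S} (hL : IsIntegralSurface (P.e 0) L) {p : S} (hp : p ∈ L) :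
    L ⊆ AddAction.orbit (ℝ × ℝ) p := by
  obtain ⟨N, _, _, f, _, _, _, _, hf, -, -, hrange, rfl⟩ := hL
  obtain ⟨y, rfl⟩ := hp
  refine range_subset_orbit hA hf (fun z v => ?_) y
  have hmem : mfderiv (𝓡 2) (𝓡 3) f z v ∈ {v | P.e 0 (f z) v = 0} := hrange z ▸ mem_range_self v
  exact hmem

theorem orbitSet_eq : orbitSet A = {L : Set S | IsLeaf (P.e 0) L} := by
  ext L
  refine ⟨?_, fun ⟨hL, hmax⟩ => ?_⟩
  · rintro ⟨p, rfl⟩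
    exact ⟨isIntegralSurface_orbit hA p, fun L' hL' h =>
      (subset_orbit hA hL' (h (AddAction.mem_orbit_self p))).antisymm h⟩
  · obtain ⟨p, hp⟩ := hL.nonempty
    exact ⟨p, hmax _ (isIntegralSurface_orbit hA p) (subset_orbit hA hL hp)⟩

end CauchyPair

end Leaves

theorem CauchyPair.exists_addAction_isGeneratedBy {S : Type*} [TopologicalSpace S] [T2Space S]
    [ChartedSpace E3 S] [IsManifold (𝓡 3) ∞ S] {P : CauchyPair S}
    (hext : ∀ i, ExtDEqWedge (P.e i) (P.thE i) (P.e 0)) (hcomp : P.IsComplete) :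
    ∃ A : AddAction (ℝ × ℝ) S, IsGeneratedBy A (P.sharp 1) (P.sharp 2) := by
  choose γ hγzero hγ using fun i => hcomp.isCompleteVField_sharp i
  have hflow (i : Fin 3) : IsFlow (P.sharp i) fun t p => γ i p t := ⟨hγzero i, hγ i⟩
  obtain ⟨A, hfst, hsnd⟩ := exists_addAction_of_isFlow (P.isSmoothVField_sharp 1)
    (P.isSmoothVField_sharp 2) (hflow 1) (hflow 2) (mlieBracket_sharp_eq_zero hext)
  exact ⟨A, fun p => ⟨hfst.isMIntegralCurve p, hsnd.isMIntegralCurve p⟩⟩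

theorem mainTheorem10_general (S : Type*) [TopologicalSpace S] [T2Space S] [ChartedSpace E3 S]
    [IsManifold (𝓡 3) ∞ S] (P : CauchyPair S)
    (hext : ∀ i, ExtDEqWedge (P.e i) (P.thE i) (P.e 0)) (hcomp : P.IsComplete) :
    (IsSmoothVField (P.sharp 1) ∧ IsCompleteVField (P.sharp 1)) ∧
    (IsSmoothVField (P.sharp 2) ∧ IsCompleteVField (P.sharp 2)) ∧
    (∀ x : S, VectorField.mlieBracket (𝓡 3) (P.sharp 1) (P.sharp 2) x = 0) ∧
    ∃ A : AddAction (ℝ × ℝ) S,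
      IsGeneratedBy A (P.sharp 1) (P.sharp 2) ∧
      (∀ B : AddAction (ℝ × ℝ) S, IsGeneratedBy B (P.sharp 1) (P.sharp 2) → B = A) ∧
      IsSmoothAction A ∧
      IsLocallyFreeAction A ∧
      orbitSet A = {L : Set S | IsLeaf (P.e 0) L} := by
  refine ⟨⟨P.isSmoothVField_sharp 1, hcomp.isCompleteVField_sharp 1⟩,
    ⟨P.isSmoothVField_sharp 2, hcomp.isCompleteVField_sharp 2⟩,
    CauchyPair.mlieBracket_sharp_eq_zero hext, ?_⟩
  obtain ⟨A, hA⟩ := CauchyPair.exists_addAction_isGeneratedBy hext hcomp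
  have hsmooth : IsSmoothAction A := CauchyPair.isSmoothAction_of_isGeneratedBy hA
  have : ContMDiffVAdd 𝓘(ℝ, ℝ × ℝ) (𝓡 3) ∞ (ℝ × ℝ) S := hsmooth
  exact ⟨A, hA,
    fun B hB => hB.eq (P.isSmoothVField_sharp 1) (P.isSmoothVField_sharp 2) hA, hsmooth,
    fun p => discreteTopology_stabilizer (CauchyPair.infinitesimalVAdd_injective hA p),
    CauchyPair.orbitSet_eq hA⟩

end

theorem mainTheorem10 (S : Type*) [TopologicalSpace S] [T2Space S] [SecondCountableTopology S]
    [ChartedSpace E3 S] [IsManifold (𝓡 3) ∞ S]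
    (P : CauchyPair S) (hpar : P.IsParallel) (hcomp : P.IsComplete) :
    (IsSmoothVField (P.sharp 1) ∧ IsCompleteVField (P.sharp 1)) ∧
    (IsSmoothVField (P.sharp 2) ∧ IsCompleteVField (P.sharp 2)) ∧
    (∀ x : S, VectorField.mlieBracket (𝓡 3) (P.sharp 1) (P.sharp 2) x = 0) ∧
    ∃ A : AddAction (ℝ × ℝ) S,
      IsGeneratedBy A (P.sharp 1) (P.sharp 2) ∧
      (∀ B : AddAction (ℝ × ℝ) S, IsGeneratedBy B (P.sharp 1) (P.sharp 2) → B = A) ∧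
      IsSmoothAction A ∧
      IsLocallyFreeAction A ∧
      orbitSet A = {L : Set S | IsLeaf (P.e 0) L} := by
  exact mainTheorem10_general S P hpar.ext_eq hcomp
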